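/- For a real number $t$ and positive integers $m,a$ let $\pi(t;m,a)$ denote the number of primes $p\le t$ with $p\equiv a \pmod m$, and let $\varphi$ be Euler's totient function. There are absolute constants $C>0$ and $\epsilon_0>0$ such that for every real $\epsilon$ with $0<\epsilon<\epsilon_0$ there is $x_0=x_0(\epsilon)$ such that for all real $x\ge x_0$ $$\sum_{x^{1-\epsilon}<m\le x}\varphi(m)\left(\int_2^x\frac{\pi(t;m,1)}{(t-1)^2}\,dt\right)^2\le C\,\epsilon\log x ,$$ where $m$ runs over the positive integers in the indicated range. -/

import Mathlib

/-- `π(t; m, a)`: the number of primes `p ≤ t` with `p ≡ a (mod m)`, for real `t`. -/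
noncomputable def primeCountingAP (t : ℝ) (m a : ℕ) : ℕ :=
  ((Finset.Icc 1 ⌊t⌋₊).filter (fun p => p.Prime ∧ p ≡ a [MOD m])).card

/-! The integral is a sum of `1/(p-1) - 1/(x-1)` over primes `p ≡ 1 (mod m)`, `p ≤ x`. With `p = k m
+ 1` and `φ(m) ≤ m`, each summand is at most `(1/m) (∑ 1/k)²`, where `k ≤ x` and `k m + 1` is prime
(`totient_mul_sq_integral_le`). Expanding the square and summing over `m` first leaves `∑ 1/(k l)`
times the sum of `1/m` over those `m ∈ (x^(1-ε), x]` for which `k m + 1` and `l m + 1` are both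
prime.

The diagonal `k = l` costs at most `2 ∑ 1/m`, which is `O(ε log x)`. Off the diagonal, Selberg's
two-dimensional sieve with level a fixed power of `x` (`selberg_upper_bound`, `card_prime_pair_le`)
saves `(log x)²`, up to a factor `(σ(q)/q)²` with `q = 2 k l (l - k)` (`log_sq_le_sieveMainSum`).
That factor is bounded on logarithmic average over `k, l` (`sum_singular_factor_le`), so the weights
`1/(k l)` contribute `O((log x)²)`, which the saving cancels. What remains is again `O(∑ 1/m)`.

Only `k < x^ε` can actually occur, but the wasteful range `k ≤ x` is affordable, since the diagonal
bound already has order `ε log x`. -/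

open Finset
open scoped ArithmeticFunction.Moebius

/-! ### Selberg's quadratic form in dimension two -/

/-- The squarefree moduli `d ≤ R` coprime to `q`. -/
def sieveModuli (q R : ℕ) : Finset ℕ :=
  (Icc 1 R).filter fun d => Squarefree d ∧ d.Coprime q

/-- The proportion `τ(d) / d` of residues modulo `d` that are removed by a two-dimensional sieve. -/
noncomputable def rootDensity (d : ℕ) : ℝ := (d.divisors.card : ℝ) / d

/-- The terms `∏_{p ∣ d} 2 / (p - 2)` of the main sum of a two-dimensional Selberg sieve. -/
noncomputable def sieveTerm (d : ℕ) : ℝ := ∏ p ∈ d.primeFactors, 2 / ((p : ℝ) - 2)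

/-- The main sum of the two-dimensional Selberg sieve with moduli coprime to `q`. -/
noncomputable def sieveMainSum (q R : ℕ) : ℝ := ∑ d ∈ sieveModuli q R, sieveTerm d

/-- Selberg's optimal weights. -/
noncomputable def selbergWeight (q R d : ℕ) : ℝ :=
  (μ d : ℝ) * (rootDensity d)⁻¹ * (∑ l ∈ (sieveModuli q R).filter (d ∣ ·), sieveTerm l) /
    sieveMainSum q R

lemma mem_sieveModuli {q R d : ℕ} :
    d ∈ sieveModuli q R ↔ (1 ≤ d ∧ d ≤ R) ∧ Squarefree d ∧ d.Coprime q := by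
  simp [sieveModuli]

lemma mem_sieveModuli_of_dvd {q R d e : ℕ} (hd : d ∈ sieveModuli q R) (h : e ∣ d) :
    e ∈ sieveModuli q R := by
  rw [mem_sieveModuli] at hd ⊢
  exact ⟨⟨Nat.pos_of_dvd_of_pos h hd.1.1, (Nat.le_of_dvd hd.1.1 h).trans hd.1.2⟩,
    hd.2.1.squarefree_of_dvd h, hd.2.2.coprime_dvd_left h⟩

lemma two_lt_of_dvd_of_coprime {q d p : ℕ} (hq : 2 ∣ q) (hd : d.Coprime q)
    (hp : p ∈ d.primeFactors) : (2 : ℝ) < p := by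
  have hpp := Nat.prime_of_mem_primeFactors hp
  have : p ≠ 2 := by
    rintro rfl
    have := Nat.dvd_gcd (Nat.dvd_of_mem_primeFactors hp) hq
    rw [hd] at this
    omega
  have := hpp.two_le
  exact_mod_cast (by omega : 2 < p)

lemma sieveTerm_pos {q d : ℕ} (hq : 2 ∣ q) (hd : d.Coprime q) : 0 < sieveTerm d :=
  prod_pos fun _ hp => div_pos two_pos (sub_pos.2 (two_lt_of_dvd_of_coprime hq hd hp))

lemma Squarefree.card_divisors_eq_two_pow {d : ℕ} (hd : Squarefree d) :
    (d.divisors.card : ℝ) = ∏ _p ∈ d.primeFactors, (2 : ℝ) := by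
  have h := (ArithmeticFunction.isMultiplicative_zeta.natCast
    (R := ℝ)).prodPrimeFactors_one_add_of_squarefree hd
  have h1 : ∑ e ∈ d.divisors, ((ArithmeticFunction.zeta : ArithmeticFunction ℝ) e) =
      d.divisors.card := by
    rw [card_eq_sum_ones, Nat.cast_sum]
    refine sum_congr rfl fun e he => ?_
    have : e ≠ 0 := (Nat.pos_of_mem_divisors he).ne'
    simp [this]
  rw [← h1, ← h]
  refine prod_congr rfl fun p hp => ?_
  have : p ≠ 0 := (Nat.prime_of_mem_primeFactors hp).ne_zero
  simp [this]
  norm_num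

lemma Squarefree.rootDensity_eq_prod {d : ℕ} (hd : Squarefree d) :
    rootDensity d = ∏ p ∈ d.primeFactors, (2 : ℝ) / p := by
  rw [rootDensity, hd.card_divisors_eq_two_pow, prod_div_distrib]
  congr 1
  conv_lhs => rw [← Nat.prod_primeFactors_of_squarefree hd]
  push_cast; rfl

lemma rootDensity_pos {d : ℕ} (hd : d ≠ 0) : 0 < rootDensity d := by
  have : 0 < d.divisors.card := card_pos.2 ⟨1, by simp [hd]⟩
  unfold rootDensity
  positivity

/-- At a prime this is `1 + (p - 2)/2 = p/2`. The identity is what diagonalises the quadratic form: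
it expands the factor at `gcd(d, e)` over common divisors. -/
lemma sum_divisors_inv_sieveTerm {d : ℕ} (hd : Squarefree d) :
    ∑ e ∈ d.divisors, (sieveTerm e)⁻¹ = (rootDensity d)⁻¹ := by
  set f := ArithmeticFunction.prodPrimeFactors (fun p : ℕ => ((p : ℝ) - 2) / 2) with hf
  have h := (ArithmeticFunction.IsMultiplicative.prodPrimeFactors
    (fun p : ℕ => ((p : ℝ) - 2) / 2)).prodPrimeFactors_one_add_of_squarefree hd
  rw [hd.rootDensity_eq_prod, ← prod_inv_distrib]
  have h1 : ∑ e ∈ d.divisors, (sieveTerm e)⁻¹ = ∑ e ∈ d.divisors, f e := by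
    refine sum_congr rfl fun e he => ?_
    rw [hf, ArithmeticFunction.prodPrimeFactors_apply (Nat.pos_of_mem_divisors he).ne', sieveTerm,
      ← prod_inv_distrib]
    exact prod_congr rfl fun p _ => by rw [inv_div]
  rw [h1, hf, ← h]
  refine prod_congr rfl fun p hp => ?_
  have hp := Nat.prime_of_mem_primeFactors hp
  rw [ArithmeticFunction.prodPrimeFactors_apply hp.ne_zero, hp.primeFactors]
  simp
  ring

lemma rootDensity_lcm {d e : ℕ} (hd : d ≠ 0) :
    rootDensity (d.lcm e) = rootDensity d * rootDensity e * (rootDensity (d.gcd e))⁻¹ := by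
  have h := (ArithmeticFunction.isMultiplicative_sigma (k := 0)).lcm_apply_mul_gcd_apply
    (x := d) (y := e)
  simp only [ArithmeticFunction.sigma_zero_apply] at h
  have h' : ((d.lcm e).divisors.card : ℝ) * (d.gcd e).divisors.card =
    d.divisors.card * e.divisors.card := by exact_mod_cast h
  have h2 : ((d.gcd e : ℕ) : ℝ) * (d.lcm e : ℕ) = d * e := by exact_mod_cast Nat.gcd_mul_lcm d e
  have hg : d.gcd e ≠ 0 := Nat.gcd_ne_zero_left hd
  rw [eq_mul_inv_iff_mul_eq₀ (rootDensity_pos hg).ne']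
  unfold rootDensity
  rw [div_mul_div_comm, div_mul_div_comm, h', ← h2, mul_comm (((d.gcd e : ℕ) : ℝ))]

/-- Put `d = e c` with `c ∣ l / e`; then `μ (e c) = μ e * μ c` and the sum over `c` vanishes unless
`l = e`. -/
lemma sum_moebius_between {l e : ℕ} (hl : Squarefree l) (he : e ∣ l) :
    ∑ d ∈ l.divisors.filter (e ∣ ·), (μ d : ℝ) = if e = l then (μ e : ℝ) else 0 := by
  obtain ⟨f, rfl⟩ := he
  have hne := hl.ne_zero
  have he0 : e ≠ 0 := left_ne_zero_of_mul hne
  have hf0 : f ≠ 0 := right_ne_zero_of_mul hne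
  have himg : (e * f).divisors.filter (e ∣ ·) = f.divisors.image (e * ·) := by
    ext d
    simp only [mem_filter, Nat.mem_divisors, mem_image]
    constructor
    · rintro ⟨⟨h1, -⟩, c, rfl⟩
      exact ⟨c, ⟨Nat.dvd_of_mul_dvd_mul_left (Nat.pos_of_ne_zero he0) h1, hf0⟩, rfl⟩
    · rintro ⟨c, ⟨h1, -⟩, rfl⟩
      exact ⟨⟨Nat.mul_dvd_mul_left _ h1, hne⟩, dvd_mul_right _ _⟩
  rw [himg, sum_image (fun a _ b _ h => Nat.eq_of_mul_eq_mul_left (Nat.pos_of_ne_zero he0) h)]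
  have h1 : ∀ c ∈ f.divisors, ((μ (e * c) : ℤ) : ℝ) = μ e * μ c := by
    intro c hc
    have hcop : e.Coprime c := (Nat.coprime_of_squarefree_mul hl).coprime_dvd_right
      (Nat.dvd_of_mem_divisors hc)
    rw [ArithmeticFunction.isMultiplicative_moebius.map_mul_of_coprime hcop]
    push_cast; rfl
  rw [sum_congr rfl h1, ← mul_sum]
  have h2 : ∑ c ∈ f.divisors, ((μ c : ℤ) : ℝ) = if f = 1 then 1 else 0 := by
    have := congrArg (fun g : ArithmeticFunction ℤ => g f) ArithmeticFunction.moebius_mul_coe_zeta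
    simp only [ArithmeticFunction.coe_mul_zeta_apply,
      ArithmeticFunction.one_apply] at this
    exact_mod_cast this
  rw [h2]
  have : e = e * f ↔ f = 1 := by
    constructor
    · intro h
      exact (Nat.eq_of_mul_eq_mul_left (Nat.pos_of_ne_zero he0) (by rw [mul_one]; exact h)).symm
    · rintro rfl; simp
  simp [this]

lemma sieveMainSum_pos {q R : ℕ} (hq : 2 ∣ q) (hR : 1 ≤ R) : 0 < sieveMainSum q R :=
  sum_pos (fun _ hd => sieveTerm_pos hq (mem_sieveModuli.1 hd).2.2)
    ⟨1, mem_sieveModuli.2 ⟨⟨le_rfl, hR⟩, squarefree_one, Nat.coprime_one_left q⟩⟩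

lemma selbergWeight_one {q R : ℕ} (hq : 2 ∣ q) (hR : 1 ≤ R) : selbergWeight q R 1 = 1 := by
  have := (sieveMainSum_pos hq hR).ne'
  simp only [selbergWeight, isUnit_one, IsUnit.dvd, filter_true, rootDensity]
  rw [← sieveMainSum]
  simp [this]

lemma one_le_card_divisors {d : ℕ} (hd : d ≠ 0) : (1 : ℝ) ≤ d.divisors.card := by
  have : 0 < d.divisors.card := card_pos.2 ⟨1, by simp [hd]⟩
  exact_mod_cast this

/-- Crude: the inner sum is part of the main sum, and `d / τ(d) ≤ R`. A power of `R` is harmless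
here, since the level is later a small power of `x`. -/
lemma abs_selbergWeight_le {q R d : ℕ} (hq : 2 ∣ q) (hR : 1 ≤ R) (hd : d ∈ sieveModuli q R) :
    |selbergWeight q R d| ≤ R := by
  have hL := sieveMainSum_pos hq hR
  obtain ⟨⟨hd1, hdR⟩, -, -⟩ := mem_sieveModuli.1 hd
  have hd0 : d ≠ 0 := by omega
  have hν := rootDensity_pos hd0
  have hpos : ∀ l ∈ sieveModuli q R, 0 ≤ sieveTerm l := fun l hl =>
    (sieveTerm_pos hq (mem_sieveModuli.1 hl).2.2).le
  have hS : ∑ l ∈ (sieveModuli q R).filter (d ∣ ·), sieveTerm l ≤ sieveMainSum q R :=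
    sum_le_sum_of_subset_of_nonneg (filter_subset _ _) fun l hl _ => hpos l hl
  have hS0 : 0 ≤ ∑ l ∈ (sieveModuli q R).filter (d ∣ ·), sieveTerm l :=
    sum_nonneg fun l hl => hpos l (mem_filter.1 hl).1
  have hμ : |(μ d : ℝ)| ≤ 1 := by exact_mod_cast ArithmeticFunction.abs_moebius_le_one (n := d)
  have hinv : (rootDensity d)⁻¹ ≤ R := by
    rw [rootDensity, inv_div]
    calc (d : ℝ) / d.divisors.card ≤ d := div_le_self (by positivity) (one_le_card_divisors hd0)
      _ ≤ R := by exact_mod_cast hdR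
  rw [selbergWeight, abs_div, abs_mul, abs_mul, abs_of_pos hL, abs_of_nonneg hS0,
    abs_of_pos (inv_pos.2 hν), div_le_iff₀ hL]
  calc _ ≤ 1 * (R : ℝ) * sieveMainSum q R := by gcongr
    _ = _ := by ring

/-- These sums are the diagonal coordinates of the form. The weights were defined by Möbius
inversion so that the coordinates take these values. -/
lemma sum_rootDensity_mul_selbergWeight {q R e : ℕ} (he : e ∈ sieveModuli q R) :
    ∑ d ∈ (sieveModuli q R).filter (e ∣ ·), rootDensity d * selbergWeight q R d =
      (μ e : ℝ) * sieveTerm e / sieveMainSum q R := by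
  have h1 : ∀ d ∈ (sieveModuli q R).filter (e ∣ ·), rootDensity d * selbergWeight q R d =
      (∑ l ∈ (sieveModuli q R), if d ∣ l then (μ d : ℝ) * sieveTerm l else 0) /
        sieveMainSum q R := by
    intro d hd
    have hd0 : d ≠ 0 := by
      have := mem_sieveModuli.1 (mem_filter.1 hd).1
      omega
    have := (rootDensity_pos hd0).ne'
    rw [selbergWeight, ← sum_filter, ← mul_sum]
    field_simp
  rw [sum_congr rfl h1, ← sum_div, sum_comm]
  congr 1
  have h2 : ∀ l ∈ sieveModuli q R, (∑ d ∈ (sieveModuli q R).filter (e ∣ ·),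
      if d ∣ l then (μ d : ℝ) * sieveTerm l else 0) =
        if e = l then (μ e : ℝ) * sieveTerm e else 0 := by
    intro l hl
    have hl' := mem_sieveModuli.1 hl
    rw [← sum_filter, ← sum_mul]
    by_cases hel : e ∣ l
    · have : ((sieveModuli q R).filter (e ∣ ·)).filter (· ∣ l) = l.divisors.filter (e ∣ ·) := by
        ext d
        simp only [mem_filter, Nat.mem_divisors]
        constructor
        · rintro ⟨⟨-, h⟩, h'⟩
          exact ⟨⟨h', by omega⟩, h⟩
        · rintro ⟨⟨h', -⟩, h⟩
          exact ⟨⟨mem_sieveModuli_of_dvd hl h', h⟩, h'⟩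
      rw [this, sum_moebius_between hl'.2.1 hel]
      split_ifs with h
      · rw [h]
      · simp
    · have : ((sieveModuli q R).filter (e ∣ ·)).filter (· ∣ l) = ∅ := by
        refine filter_eq_empty_iff.2 fun d hd hdl => hel ((mem_filter.1 hd).2.trans hdl)
      have hne : e ≠ l := fun h => hel (h ▸ dvd_rfl)
      simp [this, hne]
  rw [sum_congr rfl h2, sum_ite_eq, if_pos he]

lemma sum_selbergWeight_mul_rootDensity_lcm {q R : ℕ} (hq : 2 ∣ q) (hR : 1 ≤ R) :
    ∑ d ∈ sieveModuli q R, ∑ e ∈ sieveModuli q R,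
      selbergWeight q R d * selbergWeight q R e * rootDensity (d.lcm e) =
        (sieveMainSum q R)⁻¹ := by
  set D := sieveModuli q R with hD
  set w := selbergWeight q R with hw
  have hL := sieveMainSum_pos hq hR
  have h1 : ∀ d ∈ D, ∀ e ∈ D, w d * w e * rootDensity (d.lcm e) =
      ∑ c ∈ D, if c ∣ d ∧ c ∣ e then
        (sieveTerm c)⁻¹ * ((rootDensity d * w d) * (rootDensity e * w e)) else 0 := by
    intro d hd e he
    have hd' := mem_sieveModuli.1 hd
    have he' := mem_sieveModuli.1 he
    rw [rootDensity_lcm (by omega),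
      ← sum_divisors_inv_sieveTerm (hd'.2.1.squarefree_of_dvd (Nat.gcd_dvd_left d e)),
      ← sum_filter, ← sum_mul]
    have : D.filter (fun c => c ∣ d ∧ c ∣ e) = (d.gcd e).divisors := by
      ext c
      simp only [mem_filter, Nat.mem_divisors, Nat.dvd_gcd_iff]
      constructor
      · rintro ⟨-, h⟩
        exact ⟨h, Nat.gcd_ne_zero_left (by omega)⟩
      · rintro ⟨h, -⟩
        exact ⟨mem_sieveModuli_of_dvd hd h.1, h⟩
    rw [this]
    ring
  rw [sum_congr rfl fun d hd => sum_congr rfl (h1 d hd)]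
  have h2 : ∑ d ∈ D, ∑ e ∈ D, (∑ c ∈ D, if c ∣ d ∧ c ∣ e then
        (sieveTerm c)⁻¹ * ((rootDensity d * w d) * (rootDensity e * w e)) else 0) =
      ∑ c ∈ D, (sieveTerm c)⁻¹ * (∑ d ∈ D.filter (c ∣ ·), rootDensity d * w d) ^ 2 := by
    rw [sum_congr rfl fun d _ => sum_comm, sum_comm]
    refine sum_congr rfl fun c _ => ?_
    rw [sq, sum_mul_sum, mul_sum, sum_filter]
    refine sum_congr rfl fun d _ => ?_
    by_cases hc : c ∣ d
    · simp only [hc, true_and, if_true]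
      rw [sum_filter, mul_sum]
      exact sum_congr rfl fun e _ => by split_ifs <;> simp
    · simp [hc]
  rw [h2]
  have h3 : ∀ c ∈ D, (sieveTerm c)⁻¹ * (∑ d ∈ D.filter (c ∣ ·), rootDensity d * w d) ^ 2 =
      sieveTerm c / sieveMainSum q R ^ 2 := by
    intro c hc
    have hc' := mem_sieveModuli.1 hc
    have hpos := sieveTerm_pos hq hc'.2.2
    rw [sum_rootDensity_mul_selbergWeight hc]
    have hμ : (μ c : ℝ) ^ 2 = 1 := by
      exact_mod_cast ArithmeticFunction.moebius_sq_eq_one_of_squarefree hc'.2.1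
    rw [div_pow, mul_pow, hμ]
    field_simp
  rw [sum_congr rfl h3, ← sum_div, ← sieveMainSum]
  field_simp

/-- **Selberg's upper bound sieve** in dimension two. -/
theorem selberg_upper_bound {q R : ℕ} (hq : 2 ∣ q) (hR : 1 ≤ R) (S : Finset ℕ) (F : ℕ → ℕ) (X : ℝ)
    (hF : ∀ d, Squarefree d → d.Coprime q →
      |((S.filter fun m => d ∣ F m).card : ℝ) - rootDensity d * X| ≤ d.divisors.card) :
    ((S.filter fun m => ∀ d ∈ sieveModuli q R, d ∣ F m → d = 1).card : ℝ) ≤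
      X / sieveMainSum q R + (R : ℝ) ^ 6 := by
  set D := sieveModuli q R with hD
  set w := selbergWeight q R with hw
  have h1D : 1 ∈ D := mem_sieveModuli.2 ⟨⟨le_rfl, hR⟩, squarefree_one, Nat.coprime_one_left q⟩
  -- The square is nonnegative everywhere and equals `w 1 ^ 2 = 1` at every unsifted `m`.
  have hsq : ((S.filter fun m => ∀ d ∈ D, d ∣ F m → d = 1).card : ℝ) ≤
      ∑ m ∈ S, (∑ d ∈ D.filter (· ∣ F m), w d) ^ 2 := by
    rw [card_eq_sum_ones, Nat.cast_sum, Nat.cast_one]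
    calc ∑ m ∈ S.filter (fun m => ∀ d ∈ D, d ∣ F m → d = 1), (1 : ℝ)
        = ∑ m ∈ S.filter (fun m => ∀ d ∈ D, d ∣ F m → d = 1),
            (∑ d ∈ D.filter (· ∣ F m), w d) ^ 2 := by
          refine sum_congr rfl fun m hm => ?_
          have : D.filter (· ∣ F m) = {1} := by
            ext d
            simp only [mem_filter, mem_singleton]
            exact ⟨fun h => (mem_filter.1 hm).2 d h.1 h.2, fun h => by simp [h, h1D]⟩
          rw [this, sum_singleton, hw, selbergWeight_one hq hR, one_pow]
      _ ≤ _ := sum_le_sum_of_subset_of_nonneg (filter_subset _ _) fun _ _ _ => sq_nonneg _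
  have hexp : ∑ m ∈ S, (∑ d ∈ D.filter (· ∣ F m), w d) ^ 2 =
      ∑ d ∈ D, ∑ e ∈ D, w d * w e * ((S.filter fun m => d.lcm e ∣ F m).card : ℝ) := by
    have : ∀ m ∈ S, (∑ d ∈ D.filter (· ∣ F m), w d) ^ 2 =
        ∑ d ∈ D, ∑ e ∈ D, if d.lcm e ∣ F m then w d * w e else 0 := by
      intro m _
      rw [sq, sum_mul_sum, sum_filter]
      refine sum_congr rfl fun d _ => ?_
      by_cases hd : d ∣ F m
      · simp only [hd, if_true, Nat.lcm_dvd_iff, true_and]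
        rw [sum_filter]
      · simp [hd, Nat.lcm_dvd_iff]
    rw [sum_congr rfl this, sum_comm]
    refine sum_congr rfl fun d _ => ?_
    rw [sum_comm]
    refine sum_congr rfl fun e _ => ?_
    rw [← sum_filter, sum_const, nsmul_eq_mul, mul_comm]
  have hmain : X / sieveMainSum q R =
      ∑ d ∈ D, ∑ e ∈ D, w d * w e * (rootDensity (d.lcm e) * X) := by
    rw [div_eq_mul_inv, ← sum_selbergWeight_mul_rootDensity_lcm hq hR, mul_sum]
    refine sum_congr rfl fun d _ => ?_
    rw [mul_sum]
    exact sum_congr rfl fun e _ => by ring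
  have hRpos : (0 : ℝ) ≤ R := by positivity
  -- The weights contribute `R ^ 2` and `τ(lcm) ≤ R ^ 2`; the at most `R ^ 2` pairs then give `R ^
  -- 6` in total.
  have hterm : ∀ d ∈ D, ∀ e ∈ D,
      w d * w e * ((S.filter fun m => d.lcm e ∣ F m).card : ℝ) ≤
        w d * w e * (rootDensity (d.lcm e) * X) + (R : ℝ) ^ 4 := by
    intro d hd e he
    have hd' := mem_sieveModuli.1 hd
    have he' := mem_sieveModuli.1 he
    have hsf : Squarefree (d.lcm e) := by
      rw [Nat.squarefree_iff_factorization_le_one (Nat.lcm_ne_zero (by omega) (by omega))]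
      intro p
      rw [Nat.factorization_lcm (by omega) (by omega), Finsupp.sup_apply]
      exact sup_le (hd'.2.1.natFactorization_le_one p) (he'.2.1.natFactorization_le_one p)
    have hcop : (d.lcm e).Coprime q :=
      (hd'.2.2.mul_left he'.2.2).coprime_dvd_left (Nat.lcm_dvd_mul d e)
    have hτ : ((d.lcm e).divisors.card : ℝ) ≤ (R : ℝ) ^ 2 := by
      have h1 : (d.lcm e).divisors.card ≤ R * R :=
        (Nat.card_divisors_le_self _).trans <|
          (Nat.le_of_dvd (Nat.mul_pos hd'.1.1 he'.1.1) (Nat.lcm_dvd_mul d e)).trans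
            (Nat.mul_le_mul hd'.1.2 he'.1.2)
      rw [sq]
      exact_mod_cast h1
    have herr := (hF _ hsf hcop).trans hτ
    have hww : |w d * w e| ≤ (R : ℝ) ^ 2 := by
      rw [abs_mul, sq]
      exact mul_le_mul (abs_selbergWeight_le hq hR hd) (abs_selbergWeight_le hq hR he)
        (abs_nonneg _) hRpos
    have := (le_abs_self _).trans ((abs_mul (w d * w e) (((S.filter fun m => d.lcm e ∣ F m).card : ℝ)
      - rootDensity (d.lcm e) * X)).le.trans (mul_le_mul hww herr (abs_nonneg _) (by positivity)))
    linarith [this, show (R : ℝ) ^ 2 * (R : ℝ) ^ 2 = (R : ℝ) ^ 4 by ring]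
  have hcard : (D.card : ℝ) ≤ R := by
    have : D.card ≤ R := (card_filter_le _ _).trans (by simp)
    exact_mod_cast this
  calc _ ≤ _ := hsq
    _ = _ := hexp
    _ ≤ ∑ d ∈ D, ∑ e ∈ D, (w d * w e * (rootDensity (d.lcm e) * X) + (R : ℝ) ^ 4) :=
        sum_le_sum fun d hd => sum_le_sum (hterm d hd)
    _ = X / sieveMainSum q R + (D.card : ℝ) * ((D.card : ℝ) * (R : ℝ) ^ 4) := by
        simp only [sum_add_distrib, sum_const, nsmul_eq_mul, hmain]
    _ ≤ X / sieveMainSum q R + (R : ℝ) * ((R : ℝ) * (R : ℝ) ^ 4) := by gcongr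
    _ = _ := by ring

/-! ### Local densities for the product of two linear forms -/

lemma abs_card_Ioc_filter_modEq_sub_le {A B r : ℕ} (hAB : A ≤ B) (hr : 0 < r) (v : ℕ) :
    |(((Ioc A B).filter fun m => m ≡ v [MOD r]).card : ℝ) - ((B : ℝ) - A) / r| ≤ 1 := by
  have h := Nat.Ioc_filter_modEq_card A B hr v
  have hr' : (0 : ℚ) < r := by exact_mod_cast hr
  set x : ℚ := ((B : ℚ) - v) / r with hx
  set y : ℚ := ((A : ℚ) - v) / r with hy
  have hyx : y ≤ x := by
    have : (A : ℚ) ≤ B := by exact_mod_cast hAB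
    rw [hx, hy]
    gcongr
  rw [max_eq_left (sub_nonneg.2 (Int.floor_mono hyx))] at h
  have hq : |(((Ioc A B).filter fun m => m ≡ v [MOD r]).card : ℚ) - ((B : ℚ) - A) / r| ≤ 1 := by
    have h' : (((Ioc A B).filter fun m => m ≡ v [MOD r]).card : ℚ) = (⌊x⌋ : ℚ) - ⌊y⌋ := by
      exact_mod_cast congrArg (Int.cast : ℤ → ℚ) h
    have hxy : ((B : ℚ) - A) / r = x - y := by rw [hx, hy]; ring
    rw [h', hxy, abs_le]
    have := Int.floor_le x
    have := Int.floor_le y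
    have := Int.lt_floor_add_one x
    have := Int.lt_floor_add_one y
    constructor <;> linarith
  have hR := (Rat.cast_le (K := ℝ)).2 hq
  push_cast at hR
  exact hR

lemma exists_dvd_mul_add_one_iff_modEq {a k : ℕ} (ha : 0 < a) (hk : k.Coprime a) :
    ∃ c, ∀ m, a ∣ k * m + 1 ↔ m ≡ c [MOD a] := by
  have : NeZero a := ⟨ha.ne'⟩
  refine ⟨(-(k : ZMod a)⁻¹).val, fun m => ?_⟩
  rw [← ZMod.natCast_eq_natCast_iff, ← ZMod.natCast_eq_zero_iff, ZMod.natCast_zmod_val]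
  push_cast
  have hu : (k : ZMod a) * (k : ZMod a)⁻¹ = 1 := ZMod.coe_mul_inv_eq_one k hk
  constructor
  · intro h
    linear_combination (k : ZMod a)⁻¹ * h - (m : ZMod a) * hu
  · intro h
    linear_combination (k : ZMod a) * h - hu

lemma abs_card_filter_dvd_linear_pair_sub_le {A B a b k l : ℕ} (hAB : A ≤ B) (ha : 0 < a)
    (hb : 0 < b) (hab : a.Coprime b) (hk : k.Coprime a) (hl : l.Coprime b) :
    |(((Ioc A B).filter fun m => a ∣ k * m + 1 ∧ b ∣ l * m + 1).card : ℝ) -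
      ((B : ℝ) - A) / (a * b : ℕ)| ≤ 1 := by
  obtain ⟨c, hc⟩ := exists_dvd_mul_add_one_iff_modEq ha hk
  obtain ⟨e, he⟩ := exists_dvd_mul_add_one_iff_modEq hb hl
  obtain ⟨v, hv⟩ := Nat.chineseRemainder hab c e
  have : (Ioc A B).filter (fun m => a ∣ k * m + 1 ∧ b ∣ l * m + 1) =
      (Ioc A B).filter fun m => m ≡ v [MOD a * b] := by
    refine filter_congr fun m _ => ?_
    rw [hc, he, ← Nat.modEq_and_modEq_iff_modEq_mul hab]
    exact ⟨fun h => ⟨h.1.trans hv.1.symm, h.2.trans hv.2.symm⟩,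
      fun h => ⟨h.1.trans hv.1, h.2.trans hv.2⟩⟩
  rw [this]
  exact abs_card_Ioc_filter_modEq_sub_le hAB (Nat.mul_pos ha hb) v

/-- A common prime divisor would divide `(l - k) m`, while `p ∣ k m + 1` rules out `p ∣ m`. -/
lemma not_dvd_both_of_not_dvd_sub {p k l m : ℕ} (hp : p.Prime) (h : ¬ p ∣ l - k)
    (h1 : p ∣ k * m + 1) : ¬ p ∣ l * m + 1 := by
  intro h2
  have h3 := Nat.dvd_sub h2 h1
  rw [Nat.add_sub_add_right, ← Nat.sub_mul] at h3
  rcases hp.dvd_mul.1 h3 with h4 | h4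
  · exact h h4
  · exact hp.one_lt.ne' (Nat.dvd_one.1 ((Nat.dvd_add_right (h4.mul_left k)).1 h1))

/-- Sort the `m` by `a = gcd(d, k m + 1)`. Each of the `τ(d)` factorisations `d = a b` pins `m` to
one class modulo `d` by the Chinese remainder theorem, with error at most `1`. -/
lemma abs_card_filter_dvd_mul_sub_le {A B k l d : ℕ} (hAB : A ≤ B)
    (hd : Squarefree d) (hk : k.Coprime d) (hl : l.Coprime d) (hlk : (l - k).Coprime d) :
    |(((Ioc A B).filter fun m => d ∣ (k * m + 1) * (l * m + 1)).card : ℝ) -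
      rootDensity d * ((B : ℝ) - A)| ≤ d.divisors.card := by
  have hd0 := hd.ne_zero
  set S := (Ioc A B).filter fun m => d ∣ (k * m + 1) * (l * m + 1) with hS
  have hfib : S.card = ∑ a ∈ d.divisors,
      ((Ioc A B).filter fun m => a ∣ k * m + 1 ∧ d / a ∣ l * m + 1).card := by
    rw [card_eq_sum_card_fiberwise (f := fun m => d.gcd (k * m + 1)) (t := d.divisors)
      (fun m _ => by simp [hd0, Nat.gcd_dvd_left])]
    refine sum_congr rfl fun a ha => ?_
    congr 1
    rw [hS, filter_filter]
    refine filter_congr fun m _ => ?_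
    have had := Nat.dvd_of_mem_divisors ha
    have ha0 := Nat.pos_of_mem_divisors ha
    constructor
    · rintro ⟨h1, rfl⟩
      refine ⟨Nat.gcd_dvd_right _ _, ?_⟩
      have hcop := Nat.coprime_div_gcd_div_gcd (m := d) (n := k * m + 1) ha0
      refine hcop.dvd_of_dvd_mul_left ?_
      rw [← Nat.mul_dvd_mul_iff_left ha0, Nat.mul_div_cancel' had, ← mul_assoc,
        Nat.mul_div_cancel' (Nat.gcd_dvd_right _ _)]
      exact h1
    · rintro ⟨h1, h2⟩
      obtain ⟨b, rfl⟩ := had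
      rw [Nat.mul_div_cancel_left _ ha0] at h2
      refine ⟨Nat.mul_dvd_mul h1 h2, ?_⟩
      -- Coprimality of `l - k` and `d` makes the classes disjoint: no prime of `b` divides both
      -- linear forms.
      have hcop : b.Coprime (k * m + 1) := by
        refine Nat.Coprime.symm (Nat.coprime_of_dvd fun p hp hp1 hp2 => ?_)
        refine not_dvd_both_of_not_dvd_sub hp (fun h => ?_) hp1 (hp2.trans h2)
        have := Nat.dvd_gcd h (hp2.mul_left a)
        rw [hlk] at this
        exact hp.one_lt.ne' (Nat.dvd_one.1 this)
      rw [hcop.gcd_mul_right_cancel]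
      exact Nat.gcd_eq_left h1
  have hdens : rootDensity d * ((B : ℝ) - A) = ∑ a ∈ d.divisors, ((B : ℝ) - A) / d := by
    rw [sum_const, nsmul_eq_mul, rootDensity]
    ring
  rw [hfib, hdens, Nat.cast_sum, ← sum_sub_distrib]
  refine (abs_sum_le_sum_abs _ _).trans ?_
  rw [card_eq_sum_ones, Nat.cast_sum, Nat.cast_one]
  refine sum_le_sum fun a ha => ?_
  obtain ⟨b, rfl⟩ := Nat.dvd_of_mem_divisors ha
  have ha0 := Nat.pos_of_mem_divisors ha
  rw [Nat.mul_div_cancel_left _ ha0]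
  exact abs_card_filter_dvd_linear_pair_sub_le hAB ha0
    (Nat.pos_of_ne_zero (right_ne_zero_of_mul hd0)) (Nat.coprime_of_squarefree_mul hd)
    (hk.coprime_dvd_right (dvd_mul_right _ _)) (hl.coprime_dvd_right (dvd_mul_left _ _))

/-- Upper bound for the number of `m ∈ (A, B]` for which `k m + 1` and `l m + 1` are both prime. -/
theorem card_prime_pair_le {A B R k l : ℕ} (hR : 1 ≤ R) (hRA : R ≤ A) (hAB : A ≤ B) (hk : 0 < k)
    (hkl : k < l) :
    (((Ioc A B).filter fun m => (k * m + 1).Prime ∧ (l * m + 1).Prime).card : ℝ) ≤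
      ((B : ℝ) - A) / sieveMainSum (2 * (k * l * (l - k))) R + (R : ℝ) ^ 6 := by
  have hsieve := selberg_upper_bound (q := 2 * (k * l * (l - k))) (R := R) (dvd_mul_right _ _) hR
    (Ioc A B) (fun m => (k * m + 1) * (l * m + 1)) ((B : ℝ) - A) (fun d hd hdq => by
      refine abs_card_filter_dvd_mul_sub_le hAB hd ?_ ?_ ?_
      · exact (hdq.coprime_dvd_right (Dvd.intro_left _ (by ring : 2 * l * (l - k) * k = _))).symm
      · exact (hdq.coprime_dvd_right (Dvd.intro_left _ (by ring : 2 * k * (l - k) * l = _))).symm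
      · exact (hdq.coprime_dvd_right (Dvd.intro_left _ (by ring : 2 * k * l * (l - k) = _))).symm)
  refine le_trans ?_ hsieve
  norm_cast
  refine card_le_card fun m hm => ?_
  simp only [mem_filter, mem_Ioc] at hm ⊢
  refine ⟨hm.1, fun d hd hdvd => ?_⟩
  by_contra hd1
  obtain ⟨p, hp, hpd⟩ := Nat.exists_prime_and_dvd hd1
  have hd' := mem_sieveModuli.1 hd
  have hpR : p ≤ R := (Nat.le_of_dvd hd'.1.1 hpd).trans hd'.1.2
  -- Both primes exceed `R`, so neither can equal a prime factor of a sieve modulus.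
  have hm' : R < m := by omega
  have hkm : m ≤ k * m := Nat.le_mul_of_pos_left m hk
  have hlm : m ≤ l * m := Nat.le_mul_of_pos_left m (by omega)
  rcases hp.dvd_mul.1 (hpd.trans hdvd) with h | h
  · have := (Nat.prime_dvd_prime_iff_eq hp hm.2.1).1 h
    omega
  · have := (Nat.prime_dvd_prime_iff_eq hp hm.2.2).1 h
    omega

/-! ### Passage to logarithmic weights -/

/-- Partial summation: a linear bound for the counting function of a set bounds the logarithmic
weight of that set. -/
lemma sum_inv_filter_le_of_card_le {A : ℕ} {c E : ℝ} (P : ℕ → Prop) [DecidablePred P]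
    (h : ∀ n, A ≤ n → (((Ioc A n).filter P).card : ℝ) ≤ c * ((n : ℝ) - A) + E) {B : ℕ}
    (hAB : A ≤ B) :
    ∑ m ∈ (Ioc A B).filter P, (1 : ℝ) / m ≤ c * ∑ m ∈ Ioc A B, (1 : ℝ) / m + E / (A + 1) := by
  -- The induction closes only if the boundary term of Abel summation, the unused slack over `B +
  -- 1`, is kept. The slack is nonnegative, so enlarging its denominator only decreases it.
  suffices H : ∑ m ∈ (Ioc A B).filter P, (1 : ℝ) / m +
      (c * ((B : ℝ) - A) + E - ((Ioc A B).filter P).card) / (B + 1) ≤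
        c * ∑ m ∈ Ioc A B, (1 : ℝ) / m + E / (A + 1) by
    have : 0 ≤ (c * ((B : ℝ) - A) + E - ((Ioc A B).filter P).card) / (B + 1) :=
      div_nonneg (by linarith [h B hAB]) (by positivity)
    linarith
  induction B, hAB using Nat.le_induction with
  | base => simp
  | succ B hAB ih =>
    have hT := h (B + 1) (by omega)
    have hI : Ioc A (B + 1) = insert (B + 1) (Ioc A B) := by
      ext; simp only [mem_Ioc, mem_insert]; omega
    have hmono : ∀ T : ℝ, 0 ≤ T → T / (((B + 1 : ℕ) : ℝ) + 1) ≤ T / ((B : ℝ) + 1) := by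
      intro T hT
      apply div_le_div_of_nonneg_left hT (by positivity)
      push_cast; linarith
    have h1 := hmono _ (sub_nonneg.2 hT)
    rw [hI, sum_insert (by simp), filter_insert] at *
    split_ifs at * with hP
    · rw [sum_insert (by simp), card_insert_of_notMem (by simp)] at *
      have e : (c * (((B + 1 : ℕ) : ℝ) - A) + E - ((((Ioc A B).filter P).card + 1 : ℕ) : ℝ)) /
          ((B : ℝ) + 1) = (c * ((B : ℝ) - A) + E - ((Ioc A B).filter P).card) / (B + 1) +
            c * (1 / ((B + 1 : ℕ) : ℝ)) - 1 / ((B + 1 : ℕ) : ℝ) := by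
        push_cast; field_simp; ring
      linarith
    · have e : (c * (((B + 1 : ℕ) : ℝ) - A) + E - (((Ioc A B).filter P).card : ℝ)) /
          ((B : ℝ) + 1) = (c * ((B : ℝ) - A) + E - ((Ioc A B).filter P).card) / (B + 1) +
            c * (1 / ((B + 1 : ℕ) : ℝ)) := by
        push_cast; field_simp; ring
      linarith

/-! ### Lower bound for the main sum -/

/-- The sum `∑_{d ∣ n} 1 / d`. -/
noncomputable def sumInvDivisors (n : ℕ) : ℝ := ∑ d ∈ n.divisors, (1 : ℝ) / d

/-- Allows summing over parametrisations that hit an element several times or leave `s`; only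
covering matters. -/
lemma sum_le_sum_comp_of_subset_image {α β : Type*} [DecidableEq α] {s : Finset α} {t : Finset β}
    {g : β → α} (f : α → ℝ) (hf : ∀ b ∈ t, 0 ≤ f (g b)) (h : s ⊆ t.image g) :
    ∑ a ∈ s, f a ≤ ∑ b ∈ t, f (g b) := by
  calc ∑ a ∈ s, f a ≤ ∑ a ∈ t.image g, f a :=
        sum_le_sum_of_subset_of_nonneg h fun a ha _ => by
          obtain ⟨b, hb, rfl⟩ := mem_image.1 ha
          exact hf b hb
    _ ≤ ∑ b ∈ t, f (g b) := by
        rw [← sum_fiberwise_of_maps_to (s := t) (t := t.image g) (g := g)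
          (fun b hb => mem_image_of_mem g hb)]
        refine sum_le_sum fun a ha => ?_
        obtain ⟨b, hb, rfl⟩ := mem_image.1 ha
        exact single_le_sum (f := fun b => f (g b)) (fun b hb => hf b (mem_filter.1 hb).1)
          (mem_filter.2 ⟨hb, rfl⟩)

lemma sumInvDivisors_mul_le (m n : ℕ) :
    sumInvDivisors (m * n) ≤ sumInvDivisors m * sumInvDivisors n := by
  rw [sumInvDivisors, sumInvDivisors, sumInvDivisors, sum_mul_sum, ← sum_product']
  refine (sum_le_sum_comp_of_subset_image (t := m.divisors ×ˢ n.divisors)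
    (g := fun p : ℕ × ℕ => p.1 * p.2) (fun d : ℕ => (1 : ℝ) / d) (fun b _ => by positivity) ?_).trans
    (le_of_eq ?_)
  · intro d hd
    rw [Nat.divisors_mul, mem_mul] at hd
    obtain ⟨a, ha, b, hb, rfl⟩ := hd
    exact mem_image.2 ⟨(a, b), mem_product.2 ⟨ha, hb⟩, rfl⟩
  · refine sum_congr rfl fun p _ => ?_
    push_cast
    rw [one_div_mul_one_div]

lemma sum_Icc_inv_sq_le_two (r : ℕ) : ∑ b ∈ Icc 1 r, (1 : ℝ) / (b : ℝ) ^ 2 ≤ 2 := by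
  have h := sum_Ioo_inv_sq_le (α := ℝ) 0 (r + 1)
  have : Icc 1 r = Ioo 0 (r + 1) := by ext; simp only [mem_Icc, mem_Ioo]; omega
  rw [this]
  simpa [one_div] using h

/-- Write `n = b² a` with `a` squarefree and `a = gcd(a, q) v`; squarefreeness makes `v` coprime to
`q`. The three factors are then summed independently, with `∑ 1/b² ≤ 2`. -/
lemma sum_inv_Icc_le_sum_sieveModuli {q : ℕ} (hq : q ≠ 0) (r : ℕ) :
    ∑ n ∈ Icc 1 r, (1 : ℝ) / n ≤
      2 * sumInvDivisors q * ∑ d ∈ sieveModuli q r, (1 : ℝ) / d := by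
  have h := sum_le_sum_comp_of_subset_image (s := Icc 1 r)
    (t := Icc 1 r ×ˢ (q.divisors ×ˢ sieveModuli q r))
    (g := fun p : ℕ × ℕ × ℕ => p.1 ^ 2 * (p.2.1 * p.2.2)) (fun n : ℕ => (1 : ℝ) / n)
    (fun b _ => by positivity) (by
      intro n hn
      rw [mem_Icc] at hn
      obtain ⟨a, b, rfl, ha⟩ := Nat.sq_mul_squarefree n
      have hb0 : 0 < b := by
        rcases Nat.eq_zero_or_pos b with rfl | h
        · simp at hn
        · exact h
      have ha0 : 0 < a := Nat.pos_of_ne_zero ha.ne_zero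
      have hg0 : 0 < a.gcd q := Nat.gcd_pos_of_pos_left _ ha0
      obtain ⟨v, hv⟩ := Nat.gcd_dvd_left a q
      have hv0 : 0 < v := by
        rcases Nat.eq_zero_or_pos v with rfl | h
        · simp at hv; omega
        · exact h
      have hbr : b ≤ r := by nlinarith
      have hvr : v ≤ r := by
        have h1 : v ≤ a := by rw [hv]; exact Nat.le_mul_of_pos_left _ hg0
        have h2 : a ≤ b ^ 2 * a := Nat.le_mul_of_pos_left _ (by positivity)
        omega
      refine mem_image.2 ⟨(b, a.gcd q, v), ?_, by dsimp only; rw [← hv]⟩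
      simp only [mem_product, mem_Icc, Nat.mem_divisors, mem_sieveModuli]
      refine ⟨⟨hb0, hbr⟩, ⟨Nat.gcd_dvd_right _ _, hq⟩, ⟨hv0, hvr⟩,
        ha.squarefree_of_dvd (Dvd.intro_left _ hv.symm), ?_⟩
      refine Nat.coprime_of_dvd fun p hp hpv hpq => ?_
      have hpa : p ∣ a := hpv.trans (Dvd.intro_left _ hv.symm)
      have : p * p ∣ a := by
        rw [hv]
        exact Nat.mul_dvd_mul (Nat.dvd_gcd hpa hpq) hpv
      exact hp.one_lt.ne' (Nat.isUnit_iff.1 (ha p this)))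
  refine h.trans ?_
  have hV : 0 ≤ ∑ d ∈ sieveModuli q r, (1 : ℝ) / d := sum_nonneg fun _ _ => by positivity
  have hs : 0 ≤ sumInvDivisors q := sum_nonneg fun _ _ => by positivity
  calc _ = ∑ b ∈ Icc 1 r, (1 : ℝ) / (b : ℝ) ^ 2 *
        (sumInvDivisors q * ∑ d ∈ sieveModuli q r, (1 : ℝ) / d) := by
        rw [sum_product]
        refine sum_congr rfl fun b _ => ?_
        rw [sumInvDivisors, sum_mul_sum, ← sum_product', mul_sum]
        refine sum_congr rfl fun p _ => ?_
        push_cast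
        rw [one_div_mul_one_div, one_div_mul_one_div]
    _ = (∑ b ∈ Icc 1 r, (1 : ℝ) / (b : ℝ) ^ 2) *
        (sumInvDivisors q * ∑ d ∈ sieveModuli q r, (1 : ℝ) / d) := by rw [sum_mul]
    _ ≤ 2 * (sumInvDivisors q * ∑ d ∈ sieveModuli q r, (1 : ℝ) / d) :=
        mul_le_mul_of_nonneg_right (sum_Icc_inv_sq_le_two r) (by positivity)
    _ = _ := by ring

/-- Dividing a pair by its gcd `g` makes it coprime at the cost of a factor `1/g²`, and `∑ 1/g² ≤
2`. -/
lemma sq_sum_sieveModuli_le (q r : ℕ) :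
    (∑ d ∈ sieveModuli q r, (1 : ℝ) / d) ^ 2 ≤
      2 * ∑ p ∈ (sieveModuli q r ×ˢ sieveModuli q r).filter (fun p => p.1.Coprime p.2),
        (1 : ℝ) / (p.1 * p.2) := by
  set T := (sieveModuli q r ×ˢ sieveModuli q r).filter (fun p => p.1.Coprime p.2) with hT
  have h := sum_le_sum_comp_of_subset_image (s := sieveModuli q r ×ˢ sieveModuli q r)
    (t := Icc 1 r ×ˢ T)
    (g := fun p : ℕ × ℕ × ℕ => (p.1 * p.2.1, p.1 * p.2.2))
    (fun p : ℕ × ℕ => (1 : ℝ) / p.1 * (1 / p.2))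
    (fun b _ => by positivity) (by
      rintro ⟨a, b⟩ hab
      obtain ⟨ha, hb⟩ := mem_product.1 hab
      simp only at ha hb
      have ha' := mem_sieveModuli.1 ha
      have hg0 : 0 < a.gcd b := Nat.gcd_pos_of_pos_left _ ha'.1.1
      have hga := Nat.gcd_dvd_left a b
      have hgb := Nat.gcd_dvd_right a b
      refine mem_image.2 ⟨(a.gcd b, a / a.gcd b, b / a.gcd b), ?_, ?_⟩
      · simp only [hT, mem_product, mem_Icc, mem_filter]
        exact ⟨⟨hg0, (Nat.le_of_dvd ha'.1.1 hga).trans ha'.1.2⟩,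
          ⟨mem_sieveModuli_of_dvd ha (Nat.div_dvd_of_dvd hga),
            mem_sieveModuli_of_dvd hb (Nat.div_dvd_of_dvd hgb)⟩,
          Nat.coprime_div_gcd_div_gcd hg0⟩
      · simp only [Nat.mul_div_cancel' hga, Nat.mul_div_cancel' hgb])
  calc _ = ∑ p ∈ sieveModuli q r ×ˢ sieveModuli q r, (1 : ℝ) / p.1 * (1 / p.2) := by
        rw [sq, sum_mul_sum, ← sum_product']
    _ ≤ _ := h
    _ = (∑ b ∈ Icc 1 r, (1 : ℝ) / (b : ℝ) ^ 2) * ∑ p ∈ T, (1 : ℝ) / (p.1 * p.2) := by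
        rw [sum_mul_sum, ← sum_product']
        refine sum_congr rfl fun p _ => ?_
        push_cast
        rw [one_div_mul_one_div, one_div_mul_one_div]
        congr 1
        ring
    _ ≤ _ := mul_le_mul_of_nonneg_right (sum_Icc_inv_sq_le_two r)
        (sum_nonneg fun _ _ => by positivity)

/-- A product `d` of a coprime pair is an admissible modulus up to `r²` and arises from at most
`τ(d)` pairs. -/
lemma sum_coprime_pairs_le_sum_rootDensity (q r : ℕ) :
    ∑ p ∈ (sieveModuli q r ×ˢ sieveModuli q r).filter (fun p => p.1.Coprime p.2),
        (1 : ℝ) / (p.1 * p.2) ≤ ∑ d ∈ sieveModuli q (r * r), rootDensity d := by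
  set T := (sieveModuli q r ×ˢ sieveModuli q r).filter (fun p => p.1.Coprime p.2) with hT
  rw [← sum_fiberwise_of_maps_to (s := T) (t := sieveModuli q (r * r))
    (g := fun p : ℕ × ℕ => p.1 * p.2)]
  · refine sum_le_sum fun d hd => ?_
    have hd0 : d ≠ 0 := by
      have := mem_sieveModuli.1 hd
      omega
    have h1 : ∀ p ∈ T.filter (fun p => p.1 * p.2 = d), (1 : ℝ) / (p.1 * p.2) = 1 / d := by
      intro p hp
      rw [← (mem_filter.1 hp).2]
      push_cast; rfl
    rw [sum_congr rfl h1, sum_const, nsmul_eq_mul, rootDensity, mul_one_div]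
    gcongr
    refine card_le_card_of_injOn Prod.fst (fun p hp => ?_) fun p hp p' hp' h => ?_
    · exact Nat.mem_divisors.2 ⟨Dvd.intro _ (mem_filter.1 hp).2, hd0⟩
    · have e1 := (mem_filter.1 hp).2
      have e2 := (mem_filter.1 hp').2
      have hpos : 0 < p.1 := Nat.pos_of_ne_zero fun h0 => hd0 (by rw [← e1, h0, zero_mul])
      refine Prod.ext h (Nat.eq_of_mul_eq_mul_left hpos ?_)
      rw [e1, h, e2]
  · intro p hp
    simp only [hT, mem_filter, mem_product] at hp
    have h1 := mem_sieveModuli.1 hp.1.1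
    have h2 := mem_sieveModuli.1 hp.1.2
    exact mem_sieveModuli.2 ⟨⟨Nat.mul_pos h1.1.1 h2.1.1, Nat.mul_le_mul h1.1.2 h2.1.2⟩,
      (Nat.squarefree_mul hp.2).2 ⟨h1.2.1, h2.2.1⟩, h1.2.2.mul_left h2.2.2⟩

lemma rootDensity_le_sieveTerm {q d : ℕ} (hq : 2 ∣ q) (hd : Squarefree d) (hdq : d.Coprime q) :
    rootDensity d ≤ sieveTerm d := by
  rw [hd.rootDensity_eq_prod, sieveTerm]
  refine prod_le_prod (fun p _ => by positivity) fun p hp => ?_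
  have := two_lt_of_dvd_of_coprime hq hdq hp
  exact div_le_div_of_nonneg_left zero_le_two (by linarith) (by linarith)

lemma log_le_sum_inv_Icc (r : ℕ) : Real.log r ≤ ∑ n ∈ Icc 1 r, (1 : ℝ) / n := by
  have h := log_add_one_le_harmonic r
  rw [harmonic_eq_sum_Icc] at h
  push_cast at h
  simp only [one_div]
  refine le_trans ?_ h
  rcases Nat.eq_zero_or_pos r with rfl | hr
  · simp
  · exact Real.log_le_log (by positivity) (by linarith)

lemma sum_inv_Icc_le (n : ℕ) : ∑ k ∈ Icc 1 n, (1 : ℝ) / k ≤ 1 + Real.log n := by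
  have h := harmonic_le_one_add_log n
  rw [harmonic_eq_sum_Icc] at h
  push_cast at h
  simpa only [one_div] using h

/-- Lower bound for the main sum of the sieve. -/
theorem log_sq_le_sieveMainSum {q r : ℕ} (hq : 2 ∣ q) (hq0 : q ≠ 0) (hr : 1 ≤ r) :
    Real.log r ^ 2 ≤ 8 * sumInvDivisors q ^ 2 * sieveMainSum q (r * r) := by
  set V := ∑ d ∈ sieveModuli q r, (1 : ℝ) / d with hV
  have h1 : Real.log r ≤ 2 * sumInvDivisors q * V :=
    (log_le_sum_inv_Icc r).trans (sum_inv_Icc_le_sum_sieveModuli hq0 r)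
  have h2 : V ^ 2 ≤ 2 * sieveMainSum q (r * r) := by
    refine (sq_sum_sieveModuli_le q r).trans ?_
    gcongr
    refine (sum_coprime_pairs_le_sum_rootDensity q r).trans (sum_le_sum fun d hd => ?_)
    have := mem_sieveModuli.1 hd
    exact rootDensity_le_sieveTerm hq this.2.1 this.2.2
  have h0 : 0 ≤ Real.log r := Real.log_nonneg (by exact_mod_cast hr)
  calc Real.log r ^ 2 ≤ (2 * sumInvDivisors q * V) ^ 2 := by gcongr
    _ = 4 * sumInvDivisors q ^ 2 * V ^ 2 := by ring
    _ ≤ 4 * sumInvDivisors q ^ 2 * (2 * sieveMainSum q (r * r)) := by gcongr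
    _ = _ := by ring

/-! ### Averages of the singular factors -/

/-- The constant `ζ(5/4)`. -/
noncomputable def zetaFiveQuarters : ℝ := ∑' n : ℕ, (n : ℝ) ^ (-(5 / 4) : ℝ)

lemma sum_rpow_neg_five_quarters_le (s : Finset ℕ) :
    ∑ d ∈ s, (d : ℝ) ^ (-(5 / 4) : ℝ) ≤ zetaFiveQuarters :=
  (Real.summable_nat_rpow.2 (by norm_num)).sum_le_tsum s fun _ _ => by positivity

lemma zetaFiveQuarters_nonneg : 0 ≤ zetaFiveQuarters := tsum_nonneg fun _ => by positivity

/-- Cauchy–Schwarz after splitting `d^a = d^(-5/8) d^(b/2)`. -/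
lemma sq_sum_rpow_le {n : ℕ} {a b : ℝ} (h : 2 * a = -(5 / 4) + b) :
    (∑ d ∈ n.divisors, (d : ℝ) ^ a) ^ 2 ≤ zetaFiveQuarters * ∑ d ∈ n.divisors, (d : ℝ) ^ b := by
  have hcs := sum_mul_sq_le_sq_mul_sq n.divisors (fun d : ℕ => (d : ℝ) ^ (-(5 / 8) : ℝ))
    (fun d : ℕ => (d : ℝ) ^ (b / 2))
  have e1 : ∑ d ∈ n.divisors, (d : ℝ) ^ (-(5 / 8) : ℝ) * (d : ℝ) ^ (b / 2) =
      ∑ d ∈ n.divisors, (d : ℝ) ^ a := by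
    refine sum_congr rfl fun d hd => ?_
    have : (0 : ℝ) < d := by exact_mod_cast Nat.pos_of_mem_divisors hd
    rw [← Real.rpow_add this]
    congr 1
    linarith
  have e2 : ∀ c : ℝ, ∑ d ∈ n.divisors, ((d : ℝ) ^ c) ^ 2 = ∑ d ∈ n.divisors, (d : ℝ) ^ (2 * c) := by
    intro c
    refine sum_congr rfl fun d _ => ?_
    rw [← Real.rpow_natCast, ← Real.rpow_mul (by positivity)]
    congr 1
    push_cast; ring
  rw [e1, e2, e2, show (2 : ℝ) * (-(5 / 8)) = -(5 / 4) by norm_num,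
    show 2 * (b / 2) = b by ring] at hcs
  exact hcs.trans (mul_le_mul_of_nonneg_right (sum_rpow_neg_five_quarters_le _)
    (sum_nonneg fun _ _ => by positivity))

/-- Two rounds of Cauchy–Schwarz take the exponent from `-1` to `-3/4` to `-1/4`. The last one is
still negative, so averaging with weight `1/n` produces the convergent `∑ d^(-5/4)`. -/
lemma sumInvDivisors_pow_four_le (n : ℕ) :
    sumInvDivisors n ^ 4 ≤
      zetaFiveQuarters ^ 3 * ∑ d ∈ n.divisors, (d : ℝ) ^ (-(1 / 4) : ℝ) := by
  have hs : sumInvDivisors n = ∑ d ∈ n.divisors, (d : ℝ) ^ (-1 : ℝ) := by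
    simp [sumInvDivisors, Real.rpow_neg_one]
  have h1 := sq_sum_rpow_le (n := n) (a := -1) (b := -(3 / 4)) (by norm_num)
  have h2 := sq_sum_rpow_le (n := n) (a := -(3 / 4)) (b := -(1 / 4)) (by norm_num)
  rw [← hs] at h1
  have hz := zetaFiveQuarters_nonneg
  calc sumInvDivisors n ^ 4 = (sumInvDivisors n ^ 2) ^ 2 := by ring
    _ ≤ (zetaFiveQuarters * ∑ d ∈ n.divisors, (d : ℝ) ^ (-(3 / 4) : ℝ)) ^ 2 := by gcongr
    _ = zetaFiveQuarters ^ 2 * (∑ d ∈ n.divisors, (d : ℝ) ^ (-(3 / 4) : ℝ)) ^ 2 := by ring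
    _ ≤ zetaFiveQuarters ^ 2 *
        (zetaFiveQuarters * ∑ d ∈ n.divisors, (d : ℝ) ^ (-(1 / 4) : ℝ)) := by gcongr
    _ = _ := by ring

lemma sum_inv_filter_dvd_le {d : ℕ} (hd : 0 < d) (N : ℕ) :
    ∑ n ∈ (Icc 1 N).filter (d ∣ ·), (1 : ℝ) / n ≤ 1 / d * ∑ n ∈ Icc 1 N, (1 : ℝ) / n := by
  refine (sum_le_sum_comp_of_subset_image (t := Icc 1 N) (g := fun j => d * j)
    (fun n : ℕ => (1 : ℝ) / n) (fun _ _ => by positivity) ?_).trans (le_of_eq ?_)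
  · intro n hn
    simp only [mem_filter, mem_Icc] at hn
    obtain ⟨⟨h1, h2⟩, j, rfl⟩ := hn
    refine mem_image.2 ⟨j, mem_Icc.2 ⟨?_, ?_⟩, rfl⟩
    · exact Nat.pos_of_mul_pos_left h1
    · exact (Nat.le_mul_of_pos_left j hd).trans h2
  · rw [mul_sum]
    refine sum_congr rfl fun j _ => ?_
    push_cast
    rw [one_div_mul_one_div]

lemma sum_sumInvDivisors_pow_four_div_le (N : ℕ) :
    ∑ n ∈ Icc 1 N, sumInvDivisors n ^ 4 / n ≤
      zetaFiveQuarters ^ 4 * ∑ n ∈ Icc 1 N, (1 : ℝ) / n := by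
  have hz := zetaFiveQuarters_nonneg
  have hH : 0 ≤ ∑ n ∈ Icc 1 N, (1 : ℝ) / n := sum_nonneg fun _ _ => by positivity
  calc ∑ n ∈ Icc 1 N, sumInvDivisors n ^ 4 / n
      ≤ ∑ n ∈ Icc 1 N, (zetaFiveQuarters ^ 3 *
          ∑ d ∈ Icc 1 N, if d ∣ n then (d : ℝ) ^ (-(1 / 4) : ℝ) * (1 / n) else 0) := by
        refine sum_le_sum fun n hn => ?_
        have hn' := mem_Icc.1 hn
        have hdiv : (Icc 1 N).filter (· ∣ n) = n.divisors := by
          ext d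
          simp only [mem_filter, mem_Icc, Nat.mem_divisors]
          constructor
          · rintro ⟨-, h⟩
            exact ⟨h, by omega⟩
          · rintro ⟨h, -⟩
            exact ⟨⟨Nat.pos_of_dvd_of_pos h hn'.1, (Nat.le_of_dvd hn'.1 h).trans hn'.2⟩, h⟩
        rw [← sum_filter, hdiv, ← sum_mul, ← mul_assoc, mul_one_div]
        gcongr
        exact sumInvDivisors_pow_four_le n
    _ = zetaFiveQuarters ^ 3 * ∑ d ∈ Icc 1 N, (d : ℝ) ^ (-(1 / 4) : ℝ) *
          ∑ n ∈ (Icc 1 N).filter (d ∣ ·), (1 : ℝ) / n := by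
        rw [← mul_sum, sum_comm]
        congr 1
        refine sum_congr rfl fun d _ => ?_
        rw [← sum_filter, mul_sum]
    _ ≤ zetaFiveQuarters ^ 3 * ∑ d ∈ Icc 1 N, (d : ℝ) ^ (-(1 / 4) : ℝ) *
          (1 / d * ∑ n ∈ Icc 1 N, (1 : ℝ) / n) := by
        gcongr with d hd
        exact sum_inv_filter_dvd_le (mem_Icc.1 hd).1 N
    _ = zetaFiveQuarters ^ 3 * ((∑ d ∈ Icc 1 N, (d : ℝ) ^ (-(5 / 4) : ℝ)) *
          ∑ n ∈ Icc 1 N, (1 : ℝ) / n) := by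
        rw [sum_mul]
        congr 1
        refine sum_congr rfl fun d hd => ?_
        have hd0 : (0 : ℝ) < d := by exact_mod_cast (mem_Icc.1 hd).1
        rw [← mul_assoc]
        congr 1
        rw [show (1 : ℝ) / d = (d : ℝ) ^ (-1 : ℝ) by rw [Real.rpow_neg_one, one_div],
          ← Real.rpow_add hd0]
        norm_num
    _ ≤ zetaFiveQuarters ^ 3 * (zetaFiveQuarters * ∑ n ∈ Icc 1 N, (1 : ℝ) / n) := by
        gcongr
        exact sum_rpow_neg_five_quarters_le _
    _ = _ := by ring

lemma sumInvDivisors_nonneg (n : ℕ) : 0 ≤ sumInvDivisors n := sum_nonneg fun _ _ => by positivity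

/-- Submultiplicativity followed by `2 x y ≤ x² + y²`. This separates `h = l - k`, which is not
independent of `k` and `l`; hence the fourth powers. -/
lemma sumInvDivisors_linear_pair_sq_le (k l h : ℕ) :
    sumInvDivisors (2 * (k * l * h)) ^ 2 ≤
      2 * (sumInvDivisors k ^ 4 * sumInvDivisors l ^ 4 + sumInvDivisors h ^ 4) := by
  have h2 : sumInvDivisors 2 = 3 / 2 := by
    rw [sumInvDivisors, Nat.prime_two.divisors, sum_pair (by norm_num)]
    norm_num
  have hk := sumInvDivisors_nonneg k
  have hl := sumInvDivisors_nonneg l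
  have hh := sumInvDivisors_nonneg h
  have h0 := sumInvDivisors_nonneg (2 * (k * l * h))
  have hle : sumInvDivisors (2 * (k * l * h)) ≤
      3 / 2 * (sumInvDivisors k * sumInvDivisors l * sumInvDivisors h) := by
    refine (sumInvDivisors_mul_le _ _).trans ?_
    rw [h2]
    gcongr
    refine (sumInvDivisors_mul_le _ _).trans ?_
    gcongr
    exact sumInvDivisors_mul_le _ _
  calc _ ≤ (3 / 2 * (sumInvDivisors k * sumInvDivisors l * sumInvDivisors h)) ^ 2 := by gcongr
    _ = 9 / 4 * ((sumInvDivisors k * sumInvDivisors l) ^ 2 * sumInvDivisors h ^ 2) := by ring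
    _ ≤ _ := by
      nlinarith [sq_nonneg ((sumInvDivisors k * sumInvDivisors l) ^ 2 - sumInvDivisors h ^ 2),
        sq_nonneg ((sumInvDivisors k * sumInvDivisors l) ^ 2), sq_nonneg (sumInvDivisors h ^ 2)]

/-- The singular factors of the pairs `(k m + 1, l m + 1)` are bounded on logarithmic average. -/
theorem sum_singular_factor_le (N : ℕ) :
    ∑ k ∈ Icc 1 N, ∑ l ∈ (Icc 1 N).filter (k < ·),
      1 / ((k : ℝ) * l) * sumInvDivisors (2 * (k * l * (l - k))) ^ 2 ≤
        2 * (zetaFiveQuarters ^ 8 + zetaFiveQuarters ^ 4) * (∑ n ∈ Icc 1 N, (1 : ℝ) / n) ^ 2 := by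
  set H := ∑ n ∈ Icc 1 N, (1 : ℝ) / n with hH
  have hH0 : 0 ≤ H := sum_nonneg fun _ _ => by positivity
  have hS := sum_sumInvDivisors_pow_four_div_le N
  set S := ∑ n ∈ Icc 1 N, sumInvDivisors n ^ 4 / n with hSdef
  have hS0 : 0 ≤ S := sum_nonneg fun _ _ => by positivity
  have hpt : ∀ k ∈ Icc 1 N, ∑ l ∈ (Icc 1 N).filter (k < ·),
      1 / ((k : ℝ) * l) * sumInvDivisors (2 * (k * l * (l - k))) ^ 2 ≤
        2 * (sumInvDivisors k ^ 4 / k * S + 1 / k * S) := by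
    intro k hk
    have hk0 : (0 : ℝ) < k := by exact_mod_cast (mem_Icc.1 hk).1
    have h1 : ∑ l ∈ (Icc 1 N).filter (k < ·), sumInvDivisors l ^ 4 / l ≤ S :=
      sum_le_sum_of_subset_of_nonneg (filter_subset _ _) fun _ _ _ => by positivity
    -- Replace `1/l` by the larger `1/(l - k)` and change variables to `h = l - k`, which again lies
    -- in `[1, N]`.
    have h2 : ∑ l ∈ (Icc 1 N).filter (k < ·), sumInvDivisors (l - k) ^ 4 / l ≤ S := by
      calc ∑ l ∈ (Icc 1 N).filter (k < ·), sumInvDivisors (l - k) ^ 4 / l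
          ≤ ∑ l ∈ (Icc 1 N).filter (k < ·), sumInvDivisors (l - k) ^ 4 / (l - k : ℕ) := by
            refine sum_le_sum fun l hl => ?_
            have hl' := (mem_filter.1 hl).2
            have : (0 : ℝ) < (l - k : ℕ) := by exact_mod_cast Nat.sub_pos_of_lt hl'
            refine div_le_div_of_nonneg_left (by positivity) this ?_
            exact_mod_cast Nat.sub_le l k
        _ = ∑ h ∈ ((Icc 1 N).filter (k < ·)).image (· - k), sumInvDivisors h ^ 4 / h := by
            rw [sum_image]
            intro a ha b hb hab
            have ha' := (mem_filter.1 ha).2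
            have hb' := (mem_filter.1 hb).2
            simp only at hab
            omega
        _ ≤ S := by
            refine sum_le_sum_of_subset_of_nonneg (fun h hh => ?_) fun _ _ _ => by positivity
            obtain ⟨l, hl, rfl⟩ := mem_image.1 hh
            simp only [mem_filter, mem_Icc] at hl ⊢
            omega
    calc _ ≤ ∑ l ∈ (Icc 1 N).filter (k < ·), (2 * (sumInvDivisors k ^ 4 / k) *
          (sumInvDivisors l ^ 4 / l) + 2 * (1 / k) * (sumInvDivisors (l - k) ^ 4 / l)) := by
          refine sum_le_sum fun l hl => ?_
          have hl0 : (0 : ℝ) < l := by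
            exact_mod_cast (mem_Icc.1 (mem_filter.1 hl).1).1
          calc _ ≤ 1 / ((k : ℝ) * l) * (2 * (sumInvDivisors k ^ 4 * sumInvDivisors l ^ 4 +
                sumInvDivisors (l - k) ^ 4)) := by
                gcongr
                exact sumInvDivisors_linear_pair_sq_le _ _ _
            _ = _ := by field_simp
      _ = 2 * (sumInvDivisors k ^ 4 / k) * (∑ l ∈ (Icc 1 N).filter (k < ·),
            sumInvDivisors l ^ 4 / l) + 2 * (1 / k) * ∑ l ∈ (Icc 1 N).filter (k < ·),
            sumInvDivisors (l - k) ^ 4 / l := by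
          rw [sum_add_distrib, mul_sum, mul_sum]
      _ ≤ 2 * (sumInvDivisors k ^ 4 / k) * S + 2 * (1 / k) * S := by gcongr
      _ = _ := by ring
  have hz := zetaFiveQuarters_nonneg
  calc _ ≤ ∑ k ∈ Icc 1 N, 2 * (sumInvDivisors k ^ 4 / k * S + 1 / k * S) := sum_le_sum hpt
    _ = 2 * (S * S + H * S) := by
        rw [← mul_sum, sum_add_distrib, ← sum_mul, ← sum_mul]
    _ ≤ 2 * ((zetaFiveQuarters ^ 4 * H) * (zetaFiveQuarters ^ 4 * H) +
          H * (zetaFiveQuarters ^ 4 * H)) := by gcongr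
    _ = _ := by ring

/-! ### The second moment over `m` -/

lemma sum_sum_eq_diag_add_two_mul_of_symm {N : ℕ} {f : ℕ → ℕ → ℝ} (hf : ∀ k l, f k l = f l k) :
    ∑ k ∈ Icc 1 N, ∑ l ∈ Icc 1 N, f k l = ∑ k ∈ Icc 1 N, f k k +
      2 * ∑ k ∈ Icc 1 N, ∑ l ∈ (Icc 1 N).filter (k < ·), f k l := by
  have hsplit : ∀ k ∈ Icc 1 N, ∑ l ∈ Icc 1 N, f k l = f k k +
      ∑ l ∈ (Icc 1 N).filter (k < ·), f k l + ∑ l ∈ (Icc 1 N).filter (· < k), f k l := by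
    intro k hk
    have h1 : f k k = ∑ l ∈ Icc 1 N, if l = k then f k l else 0 := by
      rw [sum_ite_eq' (Icc 1 N) k, if_pos hk]
    rw [h1, sum_filter, sum_filter, ← sum_add_distrib, ← sum_add_distrib]
    refine sum_congr rfl fun l _ => ?_
    rcases lt_trichotomy l k with h | h | h
    · simp [h, h.ne, h.not_gt]
    · simp [h]
    · simp [h, h.ne', h.not_gt]
  have hsymm : ∑ k ∈ Icc 1 N, ∑ l ∈ (Icc 1 N).filter (· < k), f k l =
      ∑ k ∈ Icc 1 N, ∑ l ∈ (Icc 1 N).filter (k < ·), f k l := by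
    simp only [sum_filter]
    rw [sum_comm]
    exact sum_congr rfl fun l _ => sum_congr rfl fun k _ => by rw [hf]
  rw [sum_congr rfl hsplit, sum_add_distrib, sum_add_distrib, hsymm]
  ring

lemma sum_inv_prime_pair_le {A B r k l : ℕ} (hr : 2 ≤ r) (hrA : r * r ≤ A) (hAB : A ≤ B)
    (hk : 0 < k) (hkl : k < l) :
    ∑ m ∈ (Ioc A B).filter (fun m => (k * m + 1).Prime ∧ (l * m + 1).Prime), (1 : ℝ) / m ≤
      8 * sumInvDivisors (2 * (k * l * (l - k))) ^ 2 / Real.log r ^ 2 *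
        ∑ m ∈ Ioc A B, (1 : ℝ) / m + ((r * r : ℕ) : ℝ) ^ 6 / (A + 1) := by
  have hR : 1 ≤ r * r := Nat.mul_pos (by omega) (by omega)
  have hq0 : 2 * (k * l * (l - k)) ≠ 0 := by
    have : 0 < l - k := Nat.sub_pos_of_lt hkl
    have : 0 < l := by omega
    positivity
  have hlog : 0 < Real.log r := Real.log_pos (by exact_mod_cast (by omega : 1 < r))
  set L := sieveMainSum (2 * (k * l * (l - k))) (r * r) with hL
  have hL0 : 0 < L := sieveMainSum_pos (dvd_mul_right _ _) hR
  have hlow := log_sq_le_sieveMainSum (r := r) (dvd_mul_right 2 (k * l * (l - k))) hq0 (by omega)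
  rw [← hL] at hlow
  have hM : 0 ≤ ∑ m ∈ Ioc A B, (1 : ℝ) / m := sum_nonneg fun _ _ => by positivity
  have h := sum_inv_filter_le_of_card_le (A := A) (c := L⁻¹) (E := ((r * r : ℕ) : ℝ) ^ 6)
    (fun m => (k * m + 1).Prime ∧ (l * m + 1).Prime) (fun n hn => by
      have := card_prime_pair_le hR hrA hn hk hkl
      rwa [div_eq_inv_mul] at this) hAB
  refine h.trans ?_
  gcongr
  rw [le_div_iff₀ (by positivity), inv_mul_le_iff₀ hL0]
  linarith

/-- The logarithmic second moment of `∑_{k ≤ N, k m + 1 prime} 1 / k` over `m ∈ (A, B]`. -/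
theorem sum_inv_mul_sq_sum_inv_prime_le {A B N r : ℕ} (hr : 2 ≤ r) (hrA : r * r ≤ A)
    (hAB : A ≤ B) :
    ∑ m ∈ Ioc A B, (1 : ℝ) / m *
        (∑ k ∈ (Icc 1 N).filter (fun k => (k * m + 1).Prime), (1 : ℝ) / k) ^ 2 ≤
      (2 + 32 * (zetaFiveQuarters ^ 8 + zetaFiveQuarters ^ 4) *
        ((∑ k ∈ Icc 1 N, (1 : ℝ) / k) / Real.log r) ^ 2) * ∑ m ∈ Ioc A B, (1 : ℝ) / m +
      2 * (∑ k ∈ Icc 1 N, (1 : ℝ) / k) ^ 2 * (((r * r : ℕ) : ℝ) ^ 6 / (A + 1)) := by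
  set M := ∑ m ∈ Ioc A B, (1 : ℝ) / m with hM
  set H := ∑ k ∈ Icc 1 N, (1 : ℝ) / k with hH
  set E := ((r * r : ℕ) : ℝ) ^ 6 / (A + 1) with hE
  set Z := zetaFiveQuarters ^ 8 + zetaFiveQuarters ^ 4 with hZ
  have hM0 : 0 ≤ M := sum_nonneg fun _ _ => by positivity
  have hE0 : 0 ≤ E := by positivity
  set W : ℕ → ℕ → ℝ := fun k l =>
    ∑ m ∈ (Ioc A B).filter (fun m => (k * m + 1).Prime ∧ (l * m + 1).Prime), (1 : ℝ) / m with hW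
  have hexp : ∑ m ∈ Ioc A B, (1 : ℝ) / m *
        (∑ k ∈ (Icc 1 N).filter (fun k => (k * m + 1).Prime), (1 : ℝ) / k) ^ 2 =
      ∑ k ∈ Icc 1 N, ∑ l ∈ Icc 1 N, 1 / ((k : ℝ) * l) * W k l := by
    have h1 : ∀ m ∈ Ioc A B, (1 : ℝ) / m *
        (∑ k ∈ (Icc 1 N).filter (fun k => (k * m + 1).Prime), (1 : ℝ) / k) ^ 2 =
        ∑ k ∈ Icc 1 N, ∑ l ∈ Icc 1 N, if (k * m + 1).Prime ∧ (l * m + 1).Prime then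
          1 / ((k : ℝ) * l) * (1 / m) else 0 := by
      intro m _
      rw [sq, sum_mul_sum, sum_filter, mul_sum]
      refine sum_congr rfl fun k _ => ?_
      by_cases hk : (k * m + 1).Prime
      · simp only [hk, true_and, if_true]
        rw [sum_filter, mul_sum]
        refine sum_congr rfl fun l _ => ?_
        split_ifs
        · rw [one_div_mul_one_div, mul_comm]
        · simp
      · simp [hk]
    rw [sum_congr rfl h1, sum_comm]
    refine sum_congr rfl fun k _ => ?_
    rw [sum_comm]
    refine sum_congr rfl fun l _ => ?_
    rw [hW, ← sum_filter, mul_sum]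
  -- No sieve is needed here: primality is dropped and `∑ 1/k²` converges.
  have hdiag : ∑ k ∈ Icc 1 N, 1 / ((k : ℝ) * k) * W k k ≤ 2 * M := by
    calc _ ≤ ∑ k ∈ Icc 1 N, 1 / (k : ℝ) ^ 2 * M := by
          refine sum_le_sum fun k _ => ?_
          rw [← sq]
          gcongr
          exact sum_le_sum_of_subset_of_nonneg (filter_subset _ _) fun _ _ _ => by positivity
      _ ≤ 2 * M := by
          rw [← sum_mul]
          exact mul_le_mul_of_nonneg_right (sum_Icc_inv_sq_le_two N) hM0
  have hoff : ∑ k ∈ Icc 1 N, ∑ l ∈ (Icc 1 N).filter (k < ·), 1 / ((k : ℝ) * l) * W k l ≤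
      8 / Real.log r ^ 2 * M * (2 * Z * H ^ 2) + H ^ 2 * E := by
    calc _ ≤ ∑ k ∈ Icc 1 N, ∑ l ∈ (Icc 1 N).filter (k < ·),
          (8 / Real.log r ^ 2 * M *
            (1 / ((k : ℝ) * l) * sumInvDivisors (2 * (k * l * (l - k))) ^ 2) +
              1 / ((k : ℝ) * l) * E) := by
          refine sum_le_sum fun k hk => sum_le_sum fun l hl => ?_
          have := sum_inv_prime_pair_le hr hrA hAB (mem_Icc.1 hk).1 (mem_filter.1 hl).2
          calc _ ≤ 1 / ((k : ℝ) * l) * _ := mul_le_mul_of_nonneg_left this (by positivity)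
            _ = _ := by rw [← hM, ← hE]; ring
      _ = 8 / Real.log r ^ 2 * M * (∑ k ∈ Icc 1 N, ∑ l ∈ (Icc 1 N).filter (k < ·),
            1 / ((k : ℝ) * l) * sumInvDivisors (2 * (k * l * (l - k))) ^ 2) +
            (∑ k ∈ Icc 1 N, ∑ l ∈ (Icc 1 N).filter (k < ·), 1 / ((k : ℝ) * l)) * E := by
          simp only [sum_add_distrib, mul_sum, sum_mul]
      _ ≤ _ := by
          gcongr
          · exact sum_singular_factor_le N
          · calc _ ≤ ∑ k ∈ Icc 1 N, ∑ l ∈ Icc 1 N, 1 / ((k : ℝ) * l) :=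
                  sum_le_sum fun k _ => sum_le_sum_of_subset_of_nonneg (filter_subset _ _)
                    fun _ _ _ => by positivity
              _ = H ^ 2 := by
                  rw [sq, hH, sum_mul_sum]
                  simp only [one_div_mul_one_div]
  rw [hexp, sum_sum_eq_diag_add_two_mul_of_symm (f := fun k l => 1 / ((k : ℝ) * l) * W k l)
    (fun k l => by simp only [hW, mul_comm (k : ℝ), and_comm])]
  calc _ ≤ 2 * M + 2 * (8 / Real.log r ^ 2 * M * (2 * Z * H ^ 2) + H ^ 2 * E) := by gcongr
    _ = _ := by rw [div_pow]; ring

/-! ### From the integral to a sum over `k` -/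

lemma ite_le_eq_indicator_Ici (p : ℝ) (f : ℝ → ℝ) :
    (fun t => if p ≤ t then f t else 0) = (Set.Ici p).indicator f := by
  ext t
  simp [Set.indicator_apply]

lemma continuousOn_inv_sq_sub_one {a x : ℝ} (ha : 1 < a) (hax : a ≤ x) :
    ContinuousOn (fun t : ℝ => ((t - 1) ^ 2)⁻¹) (Set.uIcc a x) := by
  rw [Set.uIcc_of_le hax]
  refine ContinuousOn.inv₀ (by fun_prop) fun t ht => ?_
  have : t - 1 ≠ 0 := by have := ht.1; intro h; linarith
  positivity

lemma intervalIntegrable_ite_inv_sq (p : ℝ) {x : ℝ} (hx : 2 ≤ x) :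
    IntervalIntegrable (fun t : ℝ => if p ≤ t then ((t - 1) ^ 2)⁻¹ else 0)
      MeasureTheory.volume 2 x := by
  have h : IntervalIntegrable (fun t : ℝ => ((t - 1) ^ 2)⁻¹) MeasureTheory.volume 2 x :=
    (continuousOn_inv_sq_sub_one one_lt_two hx).intervalIntegrable
  rw [intervalIntegrable_iff_integrableOn_Ioc_of_le hx] at h ⊢
  rw [ite_le_eq_indicator_Ici p fun t => ((t - 1) ^ 2)⁻¹]
  exact h.indicator measurableSet_Ici

lemma integral_ite_inv_sq_le {p x : ℝ} (hp : 2 < p) (hpx : p ≤ x) :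
    ∫ t in (2 : ℝ)..x, (if p ≤ t then ((t - 1) ^ 2)⁻¹ else 0) ≤ 1 / (p - 1) := by
  have hderiv : ∀ t ∈ Set.uIcc p x, HasDerivAt (fun t : ℝ => -(t - 1)⁻¹) (((t - 1) ^ 2)⁻¹) t := by
    intro t ht
    rw [Set.uIcc_of_le hpx] at ht
    have ht1 : t - 1 ≠ 0 := by have := ht.1; intro h; linarith
    have := (((hasDerivAt_id t).sub_const 1).inv ht1).neg
    refine this.congr_deriv ?_
    rw [neg_div, neg_neg, one_div]
    rfl
  have hFTC := intervalIntegral.integral_eq_sub_of_hasDerivAt hderiv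
    (continuousOn_inv_sq_sub_one (by linarith) hpx).intervalIntegrable
  have heq : ∫ t in (2 : ℝ)..x, (if p ≤ t then ((t - 1) ^ 2)⁻¹ else 0) =
      ∫ t in p..x, ((t - 1) ^ 2)⁻¹ := by
    rw [intervalIntegral.integral_of_le (by linarith), intervalIntegral.integral_of_le hpx,
      ← MeasureTheory.integral_Icc_eq_integral_Ioc (x := p),
      ite_le_eq_indicator_Ici p fun t => ((t - 1) ^ 2)⁻¹,
      MeasureTheory.setIntegral_indicator measurableSet_Ici]
    congr 2
    ext t
    simp only [Set.mem_inter_iff, Set.mem_Ioc, Set.mem_Ici, Set.mem_Icc]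
    constructor
    · rintro ⟨⟨-, h1⟩, h2⟩
      exact ⟨h2, h1⟩
    · rintro ⟨h2, h1⟩
      exact ⟨⟨by linarith, h1⟩, h2⟩
  rw [heq, hFTC]
  have : 0 ≤ (x - 1)⁻¹ := inv_nonneg.2 (by linarith)
  rw [one_div]
  linarith

/-- The counting function is a sum of unit steps at the primes `p = k m + 1`, and the step at `p`
integrates to at most `1/(p - 1) = 1/(k m)`. -/
lemma integral_primeCountingAP_le {x : ℝ} {m : ℕ} (hx : 2 ≤ x) (hm : 2 ≤ m) :
    ∫ t in (2 : ℝ)..x, (primeCountingAP t m 1 : ℝ) / (t - 1) ^ 2 ≤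
      1 / m * ∑ k ∈ (Icc 1 ⌊x⌋₊).filter (fun k => (k * m + 1).Prime), (1 : ℝ) / k := by
  set T := (Icc 1 ⌊x⌋₊).filter (fun p => p.Prime ∧ p ≡ 1 [MOD m]) with hT
  have hT' : ∀ p ∈ T, (∃ k, 1 ≤ k ∧ k ≤ ⌊x⌋₊ ∧ p = k * m + 1) ∧ p.Prime ∧ p ≤ ⌊x⌋₊ := by
    intro p hp
    simp only [hT, mem_filter, mem_Icc] at hp
    refine ⟨?_, hp.2.1, hp.1.2⟩
    obtain ⟨k, hk⟩ := (Nat.modEq_iff_dvd' hp.1.1).1 hp.2.2.symm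
    have h2 := hp.2.1.two_le
    have hpk : p = k * m + 1 := by rw [mul_comm, ← hk]; omega
    have hk0 : 1 ≤ k := by
      rcases Nat.eq_zero_or_pos k with rfl | h
      · simp at hpk; omega
      · exact h
    have : k ≤ k * m := Nat.le_mul_of_pos_right k (by omega)
    exact ⟨k, hk0, by omega, hpk⟩
  have hcongr : ∫ t in (2 : ℝ)..x, (primeCountingAP t m 1 : ℝ) / (t - 1) ^ 2 =
      ∫ t in (2 : ℝ)..x, ∑ p ∈ T, (if (p : ℝ) ≤ t then ((t - 1) ^ 2)⁻¹ else 0) := by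
    refine intervalIntegral.integral_congr fun t ht => ?_
    rw [Set.uIcc_of_le hx] at ht
    have ht0 : 0 ≤ t := by linarith [ht.1]
    have hset : (Icc 1 ⌊t⌋₊).filter (fun p => p.Prime ∧ p ≡ 1 [MOD m]) =
        T.filter (fun p : ℕ => (p : ℝ) ≤ t) := by
      ext p
      have hfl : ⌊t⌋₊ ≤ ⌊x⌋₊ := Nat.floor_mono ht.2
      simp only [hT, mem_filter, mem_Icc, ← Nat.le_floor_iff ht0]
      constructor
      · rintro ⟨⟨h1, h2⟩, h3⟩
        exact ⟨⟨⟨h1, h2.trans hfl⟩, h3⟩, h2⟩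
      · rintro ⟨⟨⟨h1, -⟩, h3⟩, h2⟩
        exact ⟨⟨h1, h2⟩, h3⟩
    simp only [primeCountingAP]
    rw [hset, ← sum_filter, sum_const, nsmul_eq_mul, div_eq_mul_inv]
  rw [hcongr, intervalIntegral.integral_finsetSum fun p _ => intervalIntegrable_ite_inv_sq _ hx]
  calc _ ≤ ∑ p ∈ T, 1 / ((p : ℝ) - 1) := by
        refine sum_le_sum fun p hp => integral_ite_inv_sq_le ?_ ?_
        · obtain ⟨⟨k, hk, -, rfl⟩, -, -⟩ := hT' p hp
          have : 2 < k * m + 1 := by nlinarith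
          exact_mod_cast this
        · exact (Nat.cast_le.2 (hT' p hp).2.2).trans (Nat.floor_le (by linarith))
    _ ≤ ∑ k ∈ (Icc 1 ⌊x⌋₊).filter (fun k => (k * m + 1).Prime),
          1 / (((k * m + 1 : ℕ) : ℝ) - 1) := by
        refine sum_le_sum_comp_of_subset_image (g := fun k => k * m + 1)
          (fun p : ℕ => 1 / ((p : ℝ) - 1)) (fun k _ => ?_) fun p hp => ?_
        · push_cast
          rw [add_sub_cancel_right]
          positivity
        · obtain ⟨⟨k, hk, hkx, rfl⟩, hpr, -⟩ := hT' p hp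
          exact mem_image.2 ⟨k, mem_filter.2 ⟨mem_Icc.2 ⟨hk, hkx⟩, hpr⟩, rfl⟩
    _ = _ := by
        rw [mul_sum]
        refine sum_congr rfl fun k _ => ?_
        push_cast
        rw [add_sub_cancel_right, one_div_mul_one_div, mul_comm]

lemma integral_primeCountingAP_nonneg {x : ℝ} (hx : 2 ≤ x) (m : ℕ) :
    0 ≤ ∫ t in (2 : ℝ)..x, (primeCountingAP t m 1 : ℝ) / (t - 1) ^ 2 :=
  intervalIntegral.integral_nonneg hx fun _ _ => by positivity

lemma totient_mul_sq_integral_le {x : ℝ} {m : ℕ} (hx : 2 ≤ x) (hm : 2 ≤ m) :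
    (Nat.totient m : ℝ) * (∫ t in (2 : ℝ)..x, (primeCountingAP t m 1 : ℝ) / (t - 1) ^ 2) ^ 2 ≤
      1 / m * (∑ k ∈ (Icc 1 ⌊x⌋₊).filter (fun k => (k * m + 1).Prime), (1 : ℝ) / k) ^ 2 := by
  have hm0 : (0 : ℝ) < m := by exact_mod_cast (by omega : 0 < m)
  have h0 := integral_primeCountingAP_nonneg hx m
  calc _ ≤ (m : ℝ) * (1 / m *
        ∑ k ∈ (Icc 1 ⌊x⌋₊).filter (fun k => (k * m + 1).Prime), (1 : ℝ) / k) ^ 2 := by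
        gcongr
        · exact_mod_cast Nat.totient_le m
        · exact integral_primeCountingAP_le hx hm
    _ = _ := by field_simp

/-! ### Choice of parameters and conclusion -/

lemma sum_inv_Ioc_le_log_sub_log {A B : ℕ} (hA : 1 ≤ A) (hAB : A ≤ B) :
    ∑ m ∈ Ioc A B, (1 : ℝ) / m ≤ Real.log B - Real.log A := by
  induction B, hAB using Nat.le_induction with
  | base => simp
  | succ B hAB ih =>
    have hI : Ioc A (B + 1) = insert (B + 1) (Ioc A B) := by
      ext; simp only [mem_Ioc, mem_insert]; omega
    rw [hI, sum_insert (by simp)]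
    have hB : (0 : ℝ) < B := by exact_mod_cast (by omega : 0 < B)
    have h := Real.one_sub_inv_le_log_of_pos (x := ((B + 1 : ℕ) : ℝ) / B) (by positivity)
    rw [Real.log_div (by positivity) hB.ne'] at h
    have e : 1 - (((B + 1 : ℕ) : ℝ) / B)⁻¹ = 1 / ((B + 1 : ℕ) : ℝ) := by
      push_cast; field_simp; ring
    linarith

theorem proposition1 :
    ∃ C : ℝ, 0 < C ∧ ∃ ε₀ : ℝ, 0 < ε₀ ∧
      ∀ ε : ℝ, 0 < ε → ε < ε₀ →
        ∃ x₀ : ℝ, ∀ x : ℝ, x₀ ≤ x →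
          ∑ m ∈ (Finset.Icc 1 ⌊x⌋₊).filter (fun m : ℕ => x ^ (1 - ε) < (m : ℝ)),
              (Nat.totient m : ℝ) *
                (∫ t in (2 : ℝ)..x, (primeCountingAP t m 1 : ℝ) / (t - 1) ^ 2) ^ 2
            ≤ C * (ε * Real.log x) := by
  set Z := zetaFiveQuarters ^ 8 + zetaFiveQuarters ^ 4 with hZ
  have hZ0 : 0 ≤ Z := by have := zetaFiveQuarters_nonneg; positivity
  -- Here `160` bounds `H / log r`, the outer `2` comes from `∑ 1/m ≤ 2 ε log x`, and `800` bounds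
  -- the sieve error. Taking `ε < 1/2` keeps `m` above `x^(1/2)`.
  refine ⟨2 * (2 + 32 * Z * 160 ^ 2) + 800, by positivity, 1 / 2, by norm_num, fun ε hε hε' => ?_⟩
  -- The first bound gives `ε log x ≥ 1`, which absorbs additive constants; the second gives
  -- `x^(1/80) ≥ 2`, hence `⌊x^(1/40)⌋ ≥ x^(1/80)`.
  refine ⟨max (Real.exp (1 / ε)) (2 ^ 80), fun x hx => ?_⟩
  have hx80 : (2 : ℝ) ^ 80 ≤ x := (le_max_right _ _).trans hx
  have hx2 : (2 : ℝ) ≤ x := le_trans (by norm_num) hx80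
  have hx0 : 0 < x := by linarith
  have hx1 : 1 ≤ x := by linarith
  have hεlog : 1 ≤ ε * Real.log x := by
    have := Real.log_le_log (Real.exp_pos _) ((le_max_left _ _).trans hx)
    rw [Real.log_exp, div_le_iff₀ hε] at this
    linarith
  have hlog1 : 1 ≤ Real.log x := by nlinarith [Real.log_nonneg hx1]
  have hlog2 : Real.log 2 ≤ 1 := by linarith [Real.log_two_lt_d9]
  set A := ⌊x ^ (1 - ε)⌋₊ with hA
  set r := ⌊x ^ (1 / 40 : ℝ)⌋₊ with hr
  set H := ∑ k ∈ Icc 1 ⌊x⌋₊, (1 : ℝ) / k with hH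
  have hxA : x ^ (1 / 2 : ℝ) ≤ x ^ (1 - ε) := Real.rpow_le_rpow_of_exponent_le hx1 (by linarith)
  have hx80' : (2 : ℝ) ≤ x ^ (1 / 80 : ℝ) := by
    have := Real.rpow_le_rpow (by positivity) hx80 (show (0 : ℝ) ≤ 1 / 80 by norm_num)
    rwa [← Real.rpow_natCast, ← Real.rpow_mul (by norm_num), show ((80 : ℕ) : ℝ) * (1 / 80) = 1 by
      norm_num, Real.rpow_one] at this
  have hx40 : x ^ (1 / 40 : ℝ) = x ^ (1 / 80 : ℝ) * x ^ (1 / 80 : ℝ) := by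
    rw [← Real.rpow_add hx0]; norm_num
  have hrle : (r : ℝ) ≤ x ^ (1 / 40 : ℝ) := Nat.floor_le (by positivity)
  have hrge : x ^ (1 / 80 : ℝ) ≤ r := by
    have := Nat.lt_floor_add_one (x ^ (1 / 40 : ℝ))
    rw [← hr] at this
    nlinarith
  have hr2 : 2 ≤ r := by exact_mod_cast hx80'.trans hrge
  have hrr : ((r * r : ℕ) : ℝ) ≤ x ^ (1 / 20 : ℝ) := by
    have : x ^ (1 / 20 : ℝ) = x ^ (1 / 40 : ℝ) * x ^ (1 / 40 : ℝ) := by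
      rw [← Real.rpow_add hx0]; norm_num
    rw [this]
    push_cast
    gcongr
  have hrA : r * r ≤ A :=
    Nat.le_floor (hrr.trans (Real.rpow_le_rpow_of_exponent_le hx1 (by linarith)))
  have hA1 : 1 ≤ A := le_trans (by nlinarith) hrA
  have hAB : A ≤ ⌊x⌋₊ := Nat.floor_mono (by
    calc x ^ (1 - ε) ≤ x ^ (1 : ℝ) := Real.rpow_le_rpow_of_exponent_le hx1 (by linarith)
      _ = x := Real.rpow_one x)
  have hlogr : 1 / 80 * Real.log x ≤ Real.log r := by
    rw [← Real.log_rpow hx0]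
    exact Real.log_le_log (by positivity) hrge
  have hH0 : 0 ≤ H := sum_nonneg fun _ _ => by positivity
  have hHle : H ≤ 2 * Real.log x := by
    have h1 := sum_inv_Icc_le ⌊x⌋₊
    have h2 : Real.log (⌊x⌋₊ : ℝ) ≤ Real.log x :=
      Real.log_le_log (by exact_mod_cast (hA1.trans hAB)) (Nat.floor_le hx0.le)
    linarith
  have hHr : H / Real.log r ≤ 160 := by
    rw [div_le_iff₀ (by linarith)]
    linarith
  have hHr0 : 0 ≤ H / Real.log r := div_nonneg hH0 (by linarith)
  have hM : ∑ m ∈ Ioc A ⌊x⌋₊, (1 : ℝ) / m ≤ 2 * (ε * Real.log x) := by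
    refine (sum_inv_Ioc_le_log_sub_log hA1 hAB).trans ?_
    have h2 : Real.log (⌊x⌋₊ : ℝ) ≤ Real.log x :=
      Real.log_le_log (by exact_mod_cast (hA1.trans hAB)) (Nat.floor_le hx0.le)
    have h3 : x ^ (1 - ε) / 2 ≤ A := by
      have h4 := Nat.lt_floor_add_one (x ^ (1 - ε))
      rw [← hA] at h4
      have h5 : (1 : ℝ) ≤ A := by exact_mod_cast hA1
      linarith
    have h6 := Real.log_le_log (by positivity) h3
    rw [Real.log_div (by positivity) two_ne_zero, Real.log_rpow hx0] at h6
    linarith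
  -- The exponents balance exactly: `R^6 ≤ x^(3/10)` for the level `R = r²`, `(log x)² ≤ 100
  -- x^(1/5)`, and `A + 1 ≥ x^(1/2)`.
  have hE : 2 * H ^ 2 * (((r * r : ℕ) : ℝ) ^ 6 / (A + 1)) ≤ 800 := by
    have h1 : ((r * r : ℕ) : ℝ) ^ 6 ≤ x ^ (3 / 10 : ℝ) := by
      calc ((r * r : ℕ) : ℝ) ^ 6 ≤ (x ^ (1 / 20 : ℝ)) ^ 6 := by gcongr
        _ = x ^ (3 / 10 : ℝ) := by
          rw [← Real.rpow_natCast, ← Real.rpow_mul hx0.le]; norm_num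
    have h2 : x ^ (1 / 2 : ℝ) ≤ (A : ℝ) + 1 := hxA.trans (Nat.lt_floor_add_one _).le
    have h3 : Real.log x ≤ 10 * x ^ (1 / 10 : ℝ) := by
      have := Real.log_le_rpow_div hx0.le (show (0 : ℝ) < 1 / 10 by norm_num)
      linarith
    calc 2 * H ^ 2 * (((r * r : ℕ) : ℝ) ^ 6 / (A + 1))
        ≤ 2 * (2 * (10 * x ^ (1 / 10 : ℝ))) ^ 2 * (x ^ (3 / 10 : ℝ) / x ^ (1 / 2 : ℝ)) := by
          gcongr
          linarith
      _ = 800 * (x ^ (1 / 10 : ℝ) * x ^ (1 / 10 : ℝ) * x ^ (3 / 10 : ℝ) / x ^ (1 / 2 : ℝ)) := by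
          ring
      _ = 800 := by
          rw [← Real.rpow_add hx0, ← Real.rpow_add hx0, ← Real.rpow_sub hx0]
          norm_num
  have hset : (Icc 1 ⌊x⌋₊).filter (fun m : ℕ => x ^ (1 - ε) < (m : ℝ)) = Ioc A ⌊x⌋₊ := by
    ext m
    simp only [mem_filter, mem_Icc, mem_Ioc, hA, Nat.floor_lt (by positivity : 0 ≤ x ^ (1 - ε))]
    constructor
    · rintro ⟨⟨-, h1⟩, h2⟩
      exact ⟨h2, h1⟩
    · rintro ⟨h2, h1⟩
      have : (0 : ℝ) < m := lt_of_le_of_lt (by positivity) h2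
      exact ⟨⟨by exact_mod_cast this, h1⟩, h2⟩
  have hM0 : 0 ≤ ∑ m ∈ Ioc A ⌊x⌋₊, (1 : ℝ) / m := sum_nonneg fun _ _ => by positivity
  rw [hset]
  calc _ ≤ ∑ m ∈ Ioc A ⌊x⌋₊, (1 : ℝ) / m *
        (∑ k ∈ (Icc 1 ⌊x⌋₊).filter (fun k => (k * m + 1).Prime), (1 : ℝ) / k) ^ 2 :=
        sum_le_sum fun m hm =>
          totient_mul_sq_integral_le hx2 (by have := (mem_Ioc.1 hm).1; omega)
    _ ≤ _ := sum_inv_mul_sq_sum_inv_prime_le hr2 hrA hAB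
    _ ≤ (2 + 32 * Z * 160 ^ 2) * (2 * (ε * Real.log x)) + 800 := by
        rw [← hZ, ← hH]
        gcongr
    _ ≤ _ := by nlinarith
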